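/- Let $a\in(0,1)$ and $b>1-a$. For $\varepsilon\in[0,1]$ let $P=P_\varepsilon$ be a probability measure under which $(\eta_n)_{n\in\mathbb Z}$ are independent with $P(\eta_n=0)=\varepsilon$ and $P(\eta_n=1)=1-\varepsilon$. Let $X_0=1$, $X_1=a$, $X_{n+1}=aX_n+b\,\eta_{n-1}X_{n-1}$ for $n\ge 1$, and $W_n=\frac1{X_n}\sum_{k=0}^{n-1}X_k$. For $\varepsilon\in(0,1)$ let $(R_n)_{n\in\mathbb Z}$ be the (a.s. unique) positive stationary solution of $R_n=(a+b\,\eta_{n-1}R_{n-1})^{-1}$, i.e. the doubly infinite stationary version of the Markov chain $X_n/X_{n+1}$: $R_n=Z_{k-1}/Z_k$ where $k=\min\{j\ge 1:\eta_{n-j}=0\}$, $Z_0=1$, $Z_1=a$, $Z_{m+1}=aZ_m+bZ_{m-1}$. Put $$\gamma(\varepsilon)=\lim_{n\to\infty}\frac1n E_P(\log X_n),\qquad \varepsilon^*=\sup\{\varepsilon>0:\gamma(\varepsilon)>0\},$$ $$\Lambda_\varepsilon(t)=\lim_{n\to\infty}\frac1n\log E\bigl(R_1^t\cdots R_n^t\bigr)\quad(t\ge0),\qquad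 W^{(\varepsilon)}=\sum_{k=0}^\infty\prod_{j=0}^kR_{-j}\in[0,\infty].$$ Then $\varepsilon^*\in(0,1)$ and $\gamma(\varepsilon^*)=0$. Moreover, for every $\varepsilon\in(0,1)$: the limits defining $\gamma(\varepsilon)$ and $\Lambda_\varepsilon(t)$, $t\ge 0$, exist and are finite; $\frac1n\log X_n\to\gamma(\varepsilon)$ $P$-a.s.; $\Lambda_\varepsilon(t)=\lim_{n\to\infty}\frac1n\log E_P(X_n^{-t})$ for $t\ge0$; the one-sided derivative $\Lambda_\varepsilon'(0)$ at $0$ exists; $W_n$ converges in distribution to $W^{(\varepsilon)}$ (as $[0,\infty]$-valued random variables); and the following are equivalent: (i) $\gamma(\varepsilon)>0$; (i$'$) $\varepsilon<\varepsilon^*$; (ii) $\Lambda_\varepsilon'(0)<0$; (iii) there exists a unique $s_\varepsilon>0$ such that $\Lambda_\varepsilon(s_\varepsilon)=0$; (iv) $W^{(\varepsilon)}$ is almost surely finite and non-degenerate (not almost surely equal to a constant). -/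

import Mathlib

open MeasureTheory ProbabilityTheory Filter Set
open scoped Topology ENNReal unitInterval

namespace RandomFib

/-- The sample space: doubly infinite sequences of noise symbols; `ω n = false` encodes `η_n = 0`
and `ω n = true` encodes `η_n = 1`. -/
abbrev Noise : Type := ℤ → Bool

/-- The law `P` of the noise with parameter `ε`: the coordinates are independent,
`η_n = 0` with probability `ε` and `η_n = 1` with probability `1 - ε`. -/
noncomputable def noiseLaw (ε : I) : Measure Noise :=
  Measure.infinitePi fun _ : ℤ => bernoulliMeasure false true ε

instance noiseLaw_isProbabilityMeasure (ε : I) : IsProbabilityMeasure (noiseLaw ε) := by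
  unfold noiseLaw
  infer_instance

/-- The Bernoulli random variable `η_n`. -/
def η (n : ℤ) (ω : Noise) : ℝ := if ω n then 1 else 0

/-- The random sequence `X_0 = 1`, `X_1 = a`, `X_{n+1} = a X_n + b η_{n-1} X_{n-1}`. -/
noncomputable def X (a b : ℝ) : ℕ → Noise → ℝ
  | 0, _ => 1
  | 1, _ => a
  | n + 2, ω => a * X a b (n + 1) ω + b * η (n : ℤ) ω * X a b n ω

/-- The relative partial sums `W_n = (X_0 + ⋯ + X_{n-1}) / X_n`. -/
noncomputable def partialW (a b : ℝ) (n : ℕ) (ω : Noise) : ℝ :=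
  (∑ k ∈ Finset.range n, X a b k ω) / X a b n ω

/-- The noiseless sequence `Z_0 = 1`, `Z_1 = a`, `Z_{n+1} = a Z_n + b Z_{n-1}`. -/
noncomputable def Z (a b : ℝ) : ℕ → ℝ
  | 0 => 1
  | 1 => a
  | n + 2 => a * Z a b (n + 1) + b * Z a b n

/-- The least `k ≥ 1` such that `η_{n-k} = 0`. Such a `k` exists almost surely when `ε > 0`; on the
exceptional null set the value is `0`. -/
noncomputable def age (n : ℤ) (ω : Noise) : ℕ :=
  sInf {k : ℕ | 1 ≤ k ∧ ω (n - k) = false}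

/-- The doubly infinite stationary version `(R_n)_{n ∈ ℤ}` of the Markov chain of ratios
`X_n / X_{n+1}`, that is, the stationary solution of `R_n = (a + b η_{n-1} R_{n-1})⁻¹`
(see `R_recursion`): it is in the state `S_k = Z_{k-1} / Z_k`, where `n - k` is the time of the
last zero of the noise before time `n`. Its law under `noiseLaw ε` is the stationary law `Q`. -/
noncomputable def R (a b : ℝ) (n : ℤ) (ω : Noise) : ℝ :=
  Z a b (age n ω - 1) / Z a b (age n ω)

/-- The random variable `W = ∑_{k ≥ 0} ∏_{j=0}^{k} R_{-j}`, with values in `[0, ∞]`. -/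
noncomputable def W (a b : ℝ) (ω : Noise) : ℝ≥0∞ :=
  ∑' k : ℕ, ENNReal.ofReal (∏ j ∈ Finset.range (k + 1), R a b (-(j : ℤ)) ω)

/-- The Lyapunov exponent `γ(ε) = lim n⁻¹ E_P (log X_n)`. -/
noncomputable def γ (a b : ℝ) (ε : I) : ℝ :=
  limUnder atTop fun n : ℕ => (n : ℝ)⁻¹ * ∫ ω, Real.log (X a b n ω) ∂noiseLaw ε

/-- The critical noise level `ε* = sup {ε > 0 : γ(ε) > 0}`. -/
noncomputable def εstar (a b : ℝ) : I := sSup {ε : I | 0 < ε ∧ 0 < γ a b ε}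

/-- `Λ_ε(t) = lim n⁻¹ log E_Q (R_1^t ⋯ R_n^t)`. -/
noncomputable def Λ (a b : ℝ) (ε : I) (t : ℝ) : ℝ :=
  limUnder atTop fun n : ℕ =>
    (n : ℝ)⁻¹ * Real.log (∫ ω, ∏ k ∈ Finset.Icc 1 n, R a b (k : ℤ) ω ^ t ∂noiseLaw ε)

theorem Z_pos {a b : ℝ} (ha : 0 < a) (hb : 0 < b) : ∀ n, 0 < Z a b n
  | 0 => one_pos
  | 1 => ha
  | n + 2 => by
    have h1 := Z_pos ha hb (n + 1)
    have h2 := Z_pos ha hb n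
    rw [Z]
    positivity

theorem R_recursion {a b : ℝ} (ha : 0 < a) (hb : 0 < b) (n : ℤ) (ω : Noise)
    (h : ∃ k : ℕ, 1 ≤ k ∧ ω (n - 1 - k) = false) :
    R a b n ω = (a + b * η (n - 1) ω * R a b (n - 1) ω)⁻¹ := by
  have hmem : 1 ≤ age (n - 1) ω ∧ ω (n - 1 - age (n - 1) ω) = false :=
    Nat.sInf_mem (s := {k : ℕ | 1 ≤ k ∧ ω (n - 1 - k) = false}) h
  cases hω : ω (n - 1) with
  | false =>
    have hage : age n ω = 1 := by
      apply le_antisymm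
      · exact Nat.sInf_le (by simpa using hω)
      · exact (Nat.sInf_mem (s := {k : ℕ | 1 ≤ k ∧ ω (n - k) = false}) ⟨1, by simpa using hω⟩).1
    simp [R, hage, η, hω, Z]
  | true =>
    have hage : age n ω = age (n - 1) ω + 1 := by
      have hm : 1 ≤ age (n - 1) ω + 1 ∧ ω (n - ((age (n - 1) ω + 1 : ℕ) : ℤ)) = false := by
        refine ⟨by omega, ?_⟩
        rw [← hmem.2]
        congr 1
        push_cast
        ring
      apply le_antisymm
      · exact Nat.sInf_le hm
      · have hm' : 1 ≤ age n ω ∧ ω (n - age n ω) = false :=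
          Nat.sInf_mem (s := {k : ℕ | 1 ≤ k ∧ ω (n - k) = false}) ⟨_, hm⟩
        obtain ⟨j, hj⟩ : ∃ j, age n ω = j + 1 := ⟨age n ω - 1, by omega⟩
        rw [hj] at hm' ⊢
        have hj1 : 1 ≤ j := by
          rcases Nat.eq_zero_or_pos j with rfl | hpos
          · simp [hω] at hm'
          · exact hpos
        have : age (n - 1) ω ≤ j := by
          refine Nat.sInf_le ⟨hj1, ?_⟩
          rw [← hm'.2]
          congr 1
          push_cast
          ring
        omega
    obtain ⟨j, hj⟩ : ∃ j, age (n - 1) ω = j + 1 := ⟨age (n - 1) ω - 1, by omega⟩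
    have h1 := Z_pos ha hb (j + 1)
    have h0 := Z_pos ha hb j
    simp only [R, hage, hj, η, hω, Nat.add_sub_cancel, if_true, Z]
    field_simp

end RandomFib

/-!
Replacing the initial condition of the recursion changes its solutions only by a factor between `1`
and `1 + b / a²`. Hence `log X` is additive up to a constant, and the inverses of the products of
consecutive stationary ratios follow `X` up to the same factor. So `n⁻¹ E log X_n` and
`n⁻¹ log E X_n⁻ᵗ` converge with error `O(1 / n)`, the latter to the convex function `Λ`, and since
the error for `Λ` is `O(|t| / n)`, the derivative passes to the limit: `Λ'(0) = -γ`. Convexity and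
`Λ(t) → ∞` then characterize `γ > 0` by the positive zero of `Λ`, while Chernoff bounds for small
`t` give the almost sure growth rate and the convergence of `W` when `γ > 0`.

Conversely, `W ∘ shift = R₁ (1 + W)`, so for finite `W` the function `log R₁ + log (1 + 1 / W)` is a
coboundary. It is bounded below and therefore has mean at most zero, which forces
`-γ = E log R₁ < 0`.

The exponent `γ` is continuous and monotone in `ε` because all noise levels can be realized by
thresholding the same uniform variables. Convergence in distribution becomes almost sure convergence
once the noise is shifted so that `W_n` is read backwards from a fixed time: each of its terms is
eventually equal to the corresponding term of `W`, because a zero of the noise resets the chain of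
ratios.
-/

namespace RandomFib

section RealSequences

theorem exists_abs_sub_mul_le_of_almost_additive {u : ℕ → ℝ} {C : ℝ}
    (h : ∀ m n, |u (m + n) - (u m + u n)| ≤ C) : ∃ L, ∀ n : ℕ, |u n - n * L| ≤ C := by
  have habs (n : ℕ) : |u n| ≤ C + n * (|u 1| + C) := by
    induction n with
    | zero => simpa using h 0 0
    | succ n ih =>
      have := abs_le.1 (h n 1)
      have h1 := abs_le.1 (le_refl |u 1|)
      rw [abs_le] at ih ⊢
      push_cast
      constructor <;> linarith
  have hC : 0 ≤ C := (abs_nonneg _).trans (h 0 0)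
  have hbdd (v : ℕ → ℝ) (hv : ∀ n, -(|u n| + C) ≤ v n) : BddBelow (range fun n => v n / n) := by
    refine ⟨-(|u 1| + 3 * C), ?_⟩
    rintro _ ⟨n, rfl⟩
    rcases n.eq_zero_or_pos with rfl | hn
    · simp only [Nat.cast_zero, div_zero]
      linarith [abs_nonneg (u 1)]
    · have hn1 : (1 : ℝ) ≤ n := by exact_mod_cast hn
      rw [le_div_iff₀ (by positivity)]
      nlinarith [habs n, hv n]
  have hadd : Subadditive fun n => u n + C := fun m n => by linarith [(abs_le.1 (h m n)).2]
  have hsub : Subadditive fun n => C - u n := fun m n => by linarith [(abs_le.1 (h m n)).1]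
  have hbadd := hbdd (fun n => u n + C) fun n => by linarith [neg_abs_le (u n)]
  have hbsub := hbdd (fun n => C - u n) fun n => by linarith [le_abs_self (u n)]
  have hlim : hsub.lim = -hadd.lim := by
    have h0 := (hadd.tendsto_lim hbadd).add (hsub.tendsto_lim hbsub)
    simp only [← add_div, show ∀ n, u n + C + (C - u n) = C + C from fun n => by ring] at h0
    linarith [tendsto_nhds_unique h0 (tendsto_const_div_atTop_nhds_zero_nat (C + C))]
  refine ⟨hadd.lim, fun n => ?_⟩
  rcases n.eq_zero_or_pos with rfl | hn
  · simpa using h 0 0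
  · have hn' : (0 : ℝ) < n := by exact_mod_cast hn
    have h1 := hadd.lim_le_div hbadd hn.ne'
    have h2 := hsub.lim_le_div hbsub hn.ne'
    rw [le_div_iff₀ hn'] at h1 h2
    rw [hlim] at h2
    rw [abs_le]
    constructor <;> linarith

theorem tendsto_inv_mul_of_abs_sub_mul_le {u : ℕ → ℝ} {C L : ℝ}
    (h : ∀ n : ℕ, |u n - n * L| ≤ C) : Tendsto (fun n : ℕ => (n : ℝ)⁻¹ * u n) atTop (𝓝 L) := by
  rw [tendsto_iff_norm_sub_tendsto_zero]
  refine squeeze_zero' (.of_forall fun _ => norm_nonneg _) ?_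
    (tendsto_const_div_atTop_nhds_zero_nat C)
  filter_upwards [eventually_gt_atTop 0] with n hn
  have hn' : (0 : ℝ) < n := by exact_mod_cast hn
  rw [Real.norm_eq_abs, le_div_iff₀ hn', ← abs_of_pos hn', ← abs_mul, abs_of_pos hn']
  rw [sub_mul, mul_right_comm, inv_mul_cancel₀ hn'.ne', one_mul, mul_comm L]
  exact h n

theorem hasDerivAt_zero_of_abs_sub_mul_le {F : ℕ → ℝ → ℝ} {d : ℕ → ℝ} {ψ : ℝ → ℝ} {m C : ℝ}
    (hF0 : ∀ n, F n 0 = 0) (hF : ∀ n, HasDerivAt (F n) (d n) 0)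
    (hd : Tendsto (fun n : ℕ => (n : ℝ)⁻¹ * d n) atTop (𝓝 m))
    (hψ : ∀ (n : ℕ) t, |F n t - n * ψ t| ≤ |t| * C) : HasDerivAt ψ m 0 := by
  have hψ0 : ψ 0 = 0 := by simpa [hF0] using hψ 1 0
  rw [hasDerivAt_iff_isLittleO, Asymptotics.isLittleO_iff]
  intro c hc
  obtain ⟨n, ⟨hCn, hdn⟩, hn⟩ :=
    ((((tendsto_const_div_atTop_nhds_zero_nat C).eventually (gt_mem_nhds (by positivity :
      0 < c / 3))).and (hd.eventually (Metric.ball_mem_nhds m (by positivity : 0 < c / 3)))).and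
      (eventually_gt_atTop 0)).exists
  have hn' : (0 : ℝ) < n := by exact_mod_cast hn
  have hFn := (Asymptotics.isLittleO_iff.1 (hasDerivAt_iff_isLittleO.1 (hF n)))
    (by positivity : 0 < n * (c / 3))
  filter_upwards [hFn] with t ht
  simp only [hF0, hψ0, sub_zero, smul_eq_mul, Real.norm_eq_abs] at ht ⊢
  rw [div_lt_iff₀ hn'] at hCn
  have hd' : |d n - n * m| ≤ n * (c / 3) := by
    have : d n - n * m = n * ((n : ℝ)⁻¹ * d n - m) := by field_simp
    rw [this, abs_mul, abs_of_pos hn']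
    gcongr
    exact (Metric.mem_ball.1 hdn).le
  have hψt : (n : ℝ) * (ψ t - t * m) = -(F n t - n * ψ t) + (F n t - t * d n) + t * (d n - n * m) :=
    by ring
  refine le_of_mul_le_mul_left ?_ hn'
  calc (n : ℝ) * |ψ t - t * m| = |(n : ℝ) * (ψ t - t * m)| := by rw [abs_mul, abs_of_pos hn']
    _ ≤ |F n t - n * ψ t| + |F n t - t * d n| + |t| * |d n - n * m| := by
      rw [hψt, ← abs_mul, ← abs_neg (F n t - n * ψ t)]
      exact abs_add_three _ _ _
    _ ≤ |t| * (c / 3 * n) + n * (c / 3) * |t| + |t| * (n * (c / 3)) := by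
      gcongr
      exact (hψ n t).trans (by gcongr)
    _ = n * (c * |t|) := by ring

theorem tendsto_tsum_of_le_const_mul {ι : Type*} [Countable ι] {f : ℕ → ι → ℝ≥0∞} {g : ι → ℝ≥0∞}
    {C : ℝ≥0∞} (hC : C ≠ ∞) (hlim : ∀ i, Tendsto (f · i) atTop (𝓝 (g i)))
    (hle : ∀ n i, f n i ≤ C * g i) : Tendsto (fun n => ∑' i, f n i) atTop (𝓝 (∑' i, g i)) := by
  let _ : MeasurableSpace ι := ⊤
  simp only [← lintegral_count]
  by_cases hg : ∫⁻ i, g i ∂Measure.count = ∞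
  · rw [hg]
    refine tendsto_of_le_liminf_of_limsup_le ?_ le_top
    calc ∞ = ∫⁻ i, liminf (f · i) atTop ∂Measure.count := by simp only [(hlim _).liminf_eq, hg]
      _ ≤ _ := lintegral_liminf_le fun _ => measurable_of_countable _
  · exact tendsto_lintegral_of_dominated_convergence (fun i => C * g i)
      (fun _ => measurable_of_countable _) (fun n => .of_forall (hle n))
      (by rw [lintegral_const_mul _ (measurable_of_countable _)]; exact ENNReal.mul_ne_top hC hg)
      (.of_forall hlim)

theorem sSup_setOf_pos_spec {α : Type*} [CompleteLinearOrder α] [DenselyOrdered α]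
    [TopologicalSpace α] [OrderTopology α] {g : α → ℝ} (hg : Continuous g) (hanti : Antitone g)
    (hbot : 0 < g ⊥) (htop : g ⊤ < 0) :
    (sSup {x | ⊥ < x ∧ 0 < g x} ∈ Ioo ⊥ ⊤ ∧ g (sSup {x | ⊥ < x ∧ 0 < g x}) = 0) ∧
      ∀ x, 0 < g x ↔ x < sSup {x | ⊥ < x ∧ 0 < g x} := by
  set e := sSup {x | ⊥ < x ∧ 0 < g x}
  have lt_e : ∀ x, 0 < g x → x < e := by
    intro x hx
    have hlt : x < ⊤ := lt_top_iff_ne_top.2 (by rintro rfl; linarith)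
    have : (𝓝[>] x).NeBot := nhdsGT_neBot_of_exists_gt ⟨⊤, hlt⟩
    obtain ⟨y, hy, hxy⟩ := (((hg.tendsto x).eventually (lt_mem_nhds hx)).filter_mono
      nhdsWithin_le_nhds |>.and (self_mem_nhdsWithin : Ioi x ∈ 𝓝[>] x)).exists
    exact hxy.trans_le (le_sSup ⟨bot_le.trans_lt hxy, hy⟩)
  have pos_of_lt_e : ∀ x, x < e → 0 < g x := by
    intro x hx
    obtain ⟨y, ⟨-, hy⟩, hxy⟩ := lt_sSup_iff.1 hx
    exact hy.trans_le (hanti hxy.le)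
  have he : ⊥ < e := lt_e ⊥ hbot
  have hge : g e = 0 := by
    refine le_antisymm (not_lt.1 fun h => lt_irrefl _ (lt_e e h)) (not_lt.1 fun h => ?_)
    have : (𝓝[<] e).NeBot := nhdsLT_neBot_of_exists_lt ⟨⊥, he⟩
    obtain ⟨y, hy, hye⟩ := (((hg.tendsto e).eventually (gt_mem_nhds h)).filter_mono
      nhdsWithin_le_nhds |>.and (self_mem_nhdsWithin : Iio e ∈ 𝓝[<] e)).exists
    exact lt_asymm hy (pos_of_lt_e y hye)
  have he_top : e ≠ ⊤ := fun h => by rw [h] at hge; linarith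
  exact ⟨⟨⟨he, lt_top_iff_ne_top.2 he_top⟩, hge⟩, fun x => ⟨lt_e x, pos_of_lt_e x⟩⟩

end RealSequences

section ConvexZero

variable {f : ℝ → ℝ} {f' : ℝ}

theorem eventually_neg_of_hasDerivWithinAt (h0 : f 0 = 0)
    (hd : HasDerivWithinAt f f' (Ici 0) 0) (hf' : f' < 0) : ∀ᶠ t in 𝓝[>] (0 : ℝ), f t < 0 := by
  have hs := hasDerivWithinAt_iff_tendsto_slope.1 hd
  rw [Ici_sdiff_left] at hs
  filter_upwards [hs.eventually (gt_mem_nhds hf'), self_mem_nhdsWithin] with t ht ht0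
  rwa [slope_def_field, h0, sub_zero, sub_zero, div_lt_iff₀ (mem_Ioi.1 ht0), zero_mul] at ht

theorem mul_le_of_convexOn_of_hasDerivWithinAt (hf : ConvexOn ℝ (Ici 0) f) (h0 : f 0 = 0)
    (hd : HasDerivWithinAt f f' (Ici 0) 0) {t : ℝ} (ht : 0 < t) : t * f' ≤ f t := by
  have h := hf.le_slope_of_hasDerivWithinAt self_mem_Ici ht.le ht hd
  rwa [slope_def_field, h0, sub_zero, sub_zero, le_div_iff₀' ht] at h

theorem eq_of_convexOn_of_eq_zero (hf : ConvexOn ℝ (Ici 0) f)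
    (hneg : ∀ᶠ t in 𝓝[>] (0 : ℝ), f t < 0) {s t : ℝ} (hs : 0 < s) (ht : 0 < t) (hfs : f s = 0)
    (hft : f t = 0) : s = t := by
  by_contra hne
  wlog hst : s < t generalizing s t
  · exact this ht hs hft hfs (Ne.symm hne) ((lt_or_gt_of_ne hne).resolve_left hst)
  obtain ⟨r, hr, hr0, hrs⟩ := (hneg.and (Ioo_mem_nhdsGT hs)).exists
  have h := hf.slope_mono_adjacent hr0.le ht.le hrs hst
  rw [hfs, hft, sub_zero, zero_div, zero_sub] at h
  linarith [div_pos (neg_pos.2 hr) (sub_pos.2 hrs)]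

theorem deriv_neg_iff_existsUnique_zero (hf : ConvexOn ℝ (Ici 0) f) (h0 : f 0 = 0)
    (hd : HasDerivWithinAt f f' (Ici 0) 0) (htop : ∃ T, 0 < T ∧ 0 < f T) :
    f' < 0 ↔ ∃! s : ℝ, 0 < s ∧ f s = 0 := by
  refine ⟨fun hf' => ?_, fun ⟨s, ⟨hs, hfs⟩, huniq⟩ => ?_⟩
  · have hneg := eventually_neg_of_hasDerivWithinAt h0 hd hf'
    obtain ⟨T, hT, hfT⟩ := htop
    have hcont : ContinuousOn f (Ici 0) := hf.continuousOn_Ici hd.continuousWithinAt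
    obtain ⟨t, hft, ht, htT⟩ := (hneg.and (Ioo_mem_nhdsGT hT)).exists
    obtain ⟨s, hs, hfs⟩ := intermediate_value_Icc htT.le
      (hcont.mono fun x hx => ht.le.trans hx.1) ⟨hft.le, hfT.le⟩
    have hs0 : 0 < s := ht.trans_le hs.1
    exact ⟨s, ⟨hs0, hfs⟩, fun s' ⟨hs', hfs'⟩ =>
      eq_of_convexOn_of_eq_zero hf hneg hs' hs0 hfs' hfs⟩
  · by_contra! hf'
    have hge : 0 ≤ f (s / 2) :=
      (mul_nonneg (half_pos hs).le hf').trans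
        (mul_le_of_convexOn_of_hasDerivWithinAt hf h0 hd (half_pos hs))
    have hle := hf.2 self_mem_Ici hs.le (one_half_pos (α := ℝ)).le one_half_pos.le
      (add_halves (1 : ℝ))
    rw [h0, hfs] at hle
    simp only [smul_eq_mul, mul_zero, add_zero, zero_add, one_div_mul_eq_div] at hle
    linarith [huniq (s / 2) ⟨half_pos hs, le_antisymm hle hge⟩]

end ConvexZero

section CumulantGeneratingFunction

variable {Ω : Type*} [MeasurableSpace Ω] {μ : Measure Ω} {U V : Ω → ℝ} {s t C : ℝ}

theorem ofReal_exp_cgf [NeZero μ] (h : Integrable (fun ω => Real.exp (t * U ω)) μ) :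
    ENNReal.ofReal (Real.exp (cgf U μ t)) = ∫⁻ ω, ENNReal.ofReal (Real.exp (t * U ω)) ∂μ := by
  rw [exp_cgf h, mgf, ofReal_integral_eq_lintegral_ofReal h (.of_forall fun _ => Real.exp_nonneg _)]

theorem convexOn_cgf [NeZero μ] : ConvexOn ℝ (integrableExpSet U μ) (cgf U μ) := by
  refine ⟨convex_integrableExpSet, fun s hs t ht p q hp hq hpq => ?_⟩
  have hpow (x r : ℝ) : ENNReal.ofReal (Real.exp x) ^ r = ENNReal.ofReal (Real.exp (r * x)) := by
    rw [ENNReal.ofReal_rpow_of_pos (Real.exp_pos x), ← Real.exp_mul, mul_comm]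
  rw [← Real.exp_le_exp, ← ENNReal.ofReal_le_ofReal_iff (Real.exp_nonneg _)]
  calc ENNReal.ofReal (Real.exp (cgf U μ (p • s + q • t)))
      = ∫⁻ ω, ENNReal.ofReal (Real.exp (s * U ω)) ^ p *
          ENNReal.ofReal (Real.exp (t * U ω)) ^ q ∂μ := by
        rw [ofReal_exp_cgf (convex_integrableExpSet hs ht hp hq hpq)]
        refine lintegral_congr fun ω => ?_
        rw [hpow, hpow, ← ENNReal.ofReal_mul (Real.exp_nonneg _), ← Real.exp_add]
        simp only [smul_eq_mul]
        ring_nf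
    _ ≤ (∫⁻ ω, ENNReal.ofReal (Real.exp (s * U ω)) ∂μ) ^ p *
          (∫⁻ ω, ENNReal.ofReal (Real.exp (t * U ω)) ∂μ) ^ q :=
        ENNReal.lintegral_mul_norm_pow_le hs.1.aemeasurable.ennreal_ofReal
          ht.1.aemeasurable.ennreal_ofReal hp hq hpq
    _ = ENNReal.ofReal (Real.exp (p • cgf U μ s + q • cgf U μ t)) := by
        rw [← ofReal_exp_cgf hs, ← ofReal_exp_cgf ht, hpow, hpow,
          ← ENNReal.ofReal_mul (Real.exp_nonneg _), ← Real.exp_add, smul_eq_mul, smul_eq_mul]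

theorem mul_le_mul_add_of_abs_sub_le {x y : ℝ} (h : |x - y| ≤ C) : t * x ≤ t * y + |t| * C := by
  have : t * (x - y) ≤ |t| * C := (le_abs_self _).trans (by rw [abs_mul]; gcongr)
  linarith

theorem integrable_exp_mul_of_abs_sub_le (hU : AEMeasurable U μ)
    (hV : Integrable (fun ω => Real.exp (t * V ω)) μ) (h : ∀ᵐ ω ∂μ, |U ω - V ω| ≤ C) :
    Integrable (fun ω => Real.exp (t * U ω)) μ := by
  refine (hV.mul_const (Real.exp (|t| * C))).mono'
    (Real.measurable_exp.comp_aemeasurable (hU.const_mul t)).aestronglyMeasurable ?_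
  filter_upwards [h] with ω hω
  rw [Real.norm_eq_abs, Real.abs_exp, ← Real.exp_add, Real.exp_le_exp]
  exact mul_le_mul_add_of_abs_sub_le hω

theorem cgf_le_cgf_add [NeZero μ] (hU : Integrable (fun ω => Real.exp (t * U ω)) μ)
    (hV : Integrable (fun ω => Real.exp (t * V ω)) μ) (h : ∀ᵐ ω ∂μ, |U ω - V ω| ≤ C) :
    cgf U μ t ≤ cgf V μ t + |t| * C := by
  rw [← Real.exp_le_exp, Real.exp_add, exp_cgf hU, exp_cgf hV, mgf, mgf, ← integral_mul_const]
  refine integral_mono_ae hU (hV.mul_const _) ?_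
  filter_upwards [h] with ω hω
  rw [← Real.exp_add, Real.exp_le_exp]
  exact mul_le_mul_add_of_abs_sub_le hω

theorem abs_cgf_sub_cgf_le [NeZero μ] (hU : Integrable (fun ω => Real.exp (t * U ω)) μ)
    (hV : Integrable (fun ω => Real.exp (t * V ω)) μ) (h : ∀ᵐ ω ∂μ, |U ω - V ω| ≤ C) :
    |cgf U μ t - cgf V μ t| ≤ |t| * C := by
  have hUV := cgf_le_cgf_add hU hV h
  have hVU := cgf_le_cgf_add hV hU (by simpa only [abs_sub_comm] using h)
  rw [abs_le]
  constructor <;> linarith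

theorem abs_integral_sub_integral_le [IsProbabilityMeasure μ] (hU : Integrable U μ)
    (hV : Integrable V μ) (h : ∀ᵐ ω ∂μ, |U ω - V ω| ≤ C) :
    |∫ ω, U ω ∂μ - ∫ ω, V ω ∂μ| ≤ C := by
  rw [← integral_sub hU hV, ← Real.norm_eq_abs]
  simpa using norm_integral_le_of_norm_le_const (f := fun ω => U ω - V ω) h

end CumulantGeneratingFunction

section LargeDeviations

variable {Ω : Type*} [MeasurableSpace Ω] {μ : Measure Ω} [IsFiniteMeasure μ] {Y : ℕ → Ω → ℝ}
  {ψ : ℝ → ℝ} {m C δ : ℝ}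

theorem tsum_measure_ge_ne_top (hexp : ∀ n t, Integrable (fun ω => Real.exp (t * Y n ω)) μ)
    (hψ : ∀ (n : ℕ) t, |cgf (Y n) μ t - n * ψ t| ≤ |t| * C) (hψ0 : ψ 0 = 0)
    (hd : HasDerivAt ψ m 0) (hδ : 0 < δ) :
    ∑' n : ℕ, μ {ω | n * (m + δ) ≤ Y n ω} ≠ ∞ := by
  obtain ⟨t, ht, ht0⟩ : ∃ t, ψ t - t * (m + δ) < 0 ∧ 0 < t := by
    have hd' : HasDerivWithinAt (fun t => ψ t - t * (m + δ)) (m - 1 * (m + δ)) (Ici 0) 0 :=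
      (hd.sub ((hasDerivAt_id 0).mul_const (m + δ))).hasDerivWithinAt
    exact ((eventually_neg_of_hasDerivWithinAt (by simp [hψ0]) hd' (by linarith)).and
      self_mem_nhdsWithin).exists
  have hbound (n : ℕ) : μ {ω | n * (m + δ) ≤ Y n ω} ≤
      ENNReal.ofReal (Real.exp (t * C) * Real.exp (ψ t - t * (m + δ)) ^ n) := by
    rw [← ofReal_measureReal]
    refine ENNReal.ofReal_le_ofReal ((measure_ge_le_exp_cgf _ ht0.le (hexp n t)).trans ?_)
    rw [← Real.exp_nat_mul, ← Real.exp_add, Real.exp_le_exp]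
    have := (abs_le.1 (hψ n t)).2
    rw [abs_of_pos ht0] at this
    linarith
  have hsum : Summable fun n : ℕ =>
      Real.exp (t * C) * Real.exp (ψ t - t * (m + δ)) ^ n :=
    (summable_geometric_of_lt_one (Real.exp_nonneg _) (Real.exp_lt_one_iff.2 ht)).mul_left _
  exact ne_top_of_le_ne_top hsum.tsum_ofReal_ne_top (ENNReal.tsum_le_tsum hbound)

theorem tsum_measure_abs_sub_ge_ne_top
    (hexp : ∀ n t, Integrable (fun ω => Real.exp (t * Y n ω)) μ)
    (hψ : ∀ (n : ℕ) t, |cgf (Y n) μ t - n * ψ t| ≤ |t| * C) (hψ0 : ψ 0 = 0)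
    (hd : HasDerivAt ψ m 0) (hδ : 0 < δ) :
    ∑' n : ℕ, μ {ω | n * δ ≤ |Y n ω - n * m|} ≠ ∞ := by
  have hupper := tsum_measure_ge_ne_top hexp hψ hψ0 hd hδ
  have hd' : HasDerivAt (fun t => ψ (-t)) (-m) 0 := by
    rw [← neg_zero] at hd
    simpa [Function.comp_def] using hd.comp (0 : ℝ) (hasDerivAt_neg 0)
  have hlower := tsum_measure_ge_ne_top (Y := fun n => -Y n) (ψ := fun t => ψ (-t)) (m := -m)
    (C := C) (fun n t => by simpa using hexp n (-t))
    (fun n t => by simpa [cgf_neg] using hψ n (-t)) (by simpa using hψ0) hd' hδ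
  refine ne_top_of_le_ne_top (ENNReal.add_ne_top.2 ⟨hupper, hlower⟩) ?_
  rw [← ENNReal.tsum_add]
  refine ENNReal.tsum_le_tsum fun n => (measure_mono fun ω hω => ?_).trans (measure_union_le _ _)
  simp only [mem_ofPred_eq, mem_union, Pi.neg_apply] at hω ⊢
  rcases le_abs'.1 hω with h | h
  · right; linarith
  · left; linarith

end LargeDeviations

section Coboundary

variable {Ω : Type*} [MeasurableSpace Ω] {μ : Measure Ω} {T : Ω → Ω} {f : Ω → ℝ} {K : ℝ}

/-- Truncation of a real number to the interval `[-N, N]`. -/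
def clamp (N : ℕ) (x : ℝ) : ℝ := max (-N) (min x N)

theorem abs_clamp_le (N : ℕ) (x : ℝ) : |clamp N x| ≤ N := by
  have : (0 : ℝ) ≤ N := N.cast_nonneg
  exact abs_le.2 ⟨le_max_left _ _, max_le (by linarith) (min_le_right _ _)⟩

theorem clamp_eq_self {N : ℕ} {x : ℝ} (h : |x| ≤ N) : clamp N x = x := by
  rw [clamp, min_eq_left (abs_le.1 h).2, max_eq_right (abs_le.1 h).1]

theorem clamp_le_clamp_add {x y : ℝ} (hK : 0 ≤ K) (h : x ≤ y + K) (N : ℕ) :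
    clamp N x ≤ clamp N y + K := by
  unfold clamp
  rw [← max_add_add_right, ← min_add_add_right]
  exact max_le_max (by linarith) (min_le_min h (by linarith))

theorem measurable_clamp (N : ℕ) : Measurable (clamp N) :=
  measurable_const.max (measurable_id.min measurable_const)

theorem lintegral_coboundary_add_of_integrable [IsProbabilityMeasure μ]
    (hT : MeasurePreserving T μ μ) (hf : Integrable f μ) (h : ∀ᵐ ω ∂μ, f ω ≤ f (T ω) + K) :
    ∫⁻ ω, ENNReal.ofReal (f (T ω) - f ω + K) ∂μ = ENNReal.ofReal K := by
  have hfT : Integrable (fun ω => f (T ω)) μ := hT.integrable_comp_of_integrable hf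
  have heq : ∫ ω, f (T ω) ∂μ = ∫ ω, f ω ∂μ := by
    have := hf.aestronglyMeasurable
    rw [← hT.map_eq] at this
    rw [← integral_map hT.measurable.aemeasurable this, hT.map_eq]
  have hint : Integrable (fun ω => f (T ω) - f ω) μ := hfT.sub hf
  have hintK : Integrable (fun ω => f (T ω) - f ω + K) μ := hint.add (integrable_const K)
  rw [← ofReal_integral_eq_lintegral_ofReal hintK, integral_add hint (integrable_const K),
    integral_sub hfT hf, heq]
  · simp
  · filter_upwards [h] with ω hω
    simp only [Pi.zero_apply]
    linarith

theorem lintegral_coboundary_add_le [IsProbabilityMeasure μ] (hT : MeasurePreserving T μ μ)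
    (hf : Measurable f) (hK : 0 ≤ K) (h : ∀ᵐ ω ∂μ, f ω ≤ f (T ω) + K) :
    ∫⁻ ω, ENNReal.ofReal (f (T ω) - f ω + K) ∂μ ≤ ENNReal.ofReal K := by
  have hmeas (N : ℕ) : Measurable fun ω => clamp N (f ω) := (measurable_clamp N).comp hf
  have hint (N : ℕ) : ∫⁻ ω, ENNReal.ofReal (clamp N (f (T ω)) - clamp N (f ω) + K) ∂μ =
      ENNReal.ofReal K :=
    lintegral_coboundary_add_of_integrable hT
      (.of_bound (hmeas N).aestronglyMeasurable N (.of_forall fun _ => abs_clamp_le N _))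
      (h.mono fun ω hω => clamp_le_clamp_add hK hω N)
  have hlim (x : ℝ) : ∀ᶠ N : ℕ in atTop, clamp N x = x := by
    filter_upwards [eventually_ge_atTop ⌈|x|⌉₊] with N hN using clamp_eq_self (Nat.ceil_le.1 hN)
  calc ∫⁻ ω, ENNReal.ofReal (f (T ω) - f ω + K) ∂μ
      = ∫⁻ ω, liminf (fun N : ℕ =>
          ENNReal.ofReal (clamp N (f (T ω)) - clamp N (f ω) + K)) atTop ∂μ := by
        refine lintegral_congr fun ω => (Tendsto.liminf_eq (tendsto_const_nhds.congr' ?_)).symm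
        filter_upwards [hlim (f ω), hlim (f (T ω))] with N h1 h2
        rw [h1, h2]
    _ ≤ liminf (fun N : ℕ =>
          ∫⁻ ω, ENNReal.ofReal (clamp N (f (T ω)) - clamp N (f ω) + K) ∂μ) atTop :=
        lintegral_liminf_le fun N =>
          ((((hmeas N).comp hT.measurable).sub (hmeas N)).add_const K).ennreal_ofReal
    _ = ENNReal.ofReal K := by simp only [hint, liminf_const]

theorem integrable_coboundary [IsProbabilityMeasure μ] (hT : MeasurePreserving T μ μ)
    (hf : Measurable f) (hK : 0 ≤ K) (h : ∀ᵐ ω ∂μ, f ω ≤ f (T ω) + K) :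
    Integrable (fun ω => f (T ω) - f ω) μ := by
  have hm : Measurable fun ω => f (T ω) - f ω + K :=
    ((hf.comp hT.measurable).sub hf).add_const K
  have hnn : 0 ≤ᵐ[μ] fun ω => f (T ω) - f ω + K := h.mono fun ω hω => by
    simp only [Pi.zero_apply]; linarith
  have : Integrable (fun ω => f (T ω) - f ω + K) μ :=
    (lintegral_ofReal_ne_top_iff_integrable hm.aestronglyMeasurable hnn).1
      (ne_top_of_le_ne_top ENNReal.ofReal_ne_top (lintegral_coboundary_add_le hT hf hK h))
  simpa [Pi.sub_def] using this.sub (integrable_const K)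

theorem integral_coboundary_nonpos [IsProbabilityMeasure μ] (hT : MeasurePreserving T μ μ)
    (hf : Measurable f) (hK : 0 ≤ K) (h : ∀ᵐ ω ∂μ, f ω ≤ f (T ω) + K) :
    ∫ ω, (f (T ω) - f ω) ∂μ ≤ 0 := by
  have hint := integrable_coboundary hT hf hK h
  have hle := lintegral_coboundary_add_le hT hf hK h
  have hintK : Integrable (fun ω => f (T ω) - f ω + K) μ := hint.add (integrable_const K)
  rw [← ofReal_integral_eq_lintegral_ofReal hintK
    (h.mono fun ω hω => by simp only [Pi.zero_apply]; linarith),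
    ENNReal.ofReal_le_ofReal_iff hK, integral_add hint (integrable_const K)] at hle
  simpa using hle

end Coboundary

theorem measurable_sInf_nat {α : Type*} [MeasurableSpace α] {s : α → Set ℕ}
    (hs : ∀ k, MeasurableSet {x | k ∈ s x}) : Measurable fun x => sInf (s x) := by
  refine measurable_of_Ioi fun k => ?_
  have : (fun x => sInf (s x)) ⁻¹' Ioi k = (⋃ j, {x | j ∈ s x}) ∩ ⋂ j ≤ k, {x | j ∈ s x}ᶜ := by
    ext x
    simp only [mem_preimage, mem_Ioi, mem_inter_iff, mem_iUnion, mem_iInter, mem_compl_iff,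
      mem_ofPred_eq]
    refine ⟨fun h => ⟨?_, fun j hj hjs => (h.trans_le (Nat.sInf_le hjs)).not_ge hj⟩,
      fun ⟨hne, h⟩ => not_le.1 fun hle => h _ hle (Nat.sInf_mem hne)⟩
    exact Nat.nonempty_of_pos_sInf (k.zero_le.trans_lt h)
  rw [this]
  exact (MeasurableSet.iUnion hs).inter
    (.iInter fun j => .iInter fun _ => (hs j).compl)

section Noise

/-- The shift of the noise by `m`, `(shift m ω) k = ω (k + m)`, as a measurable equivalence. -/
def shift (m : ℤ) : Noise ≃ᵐ Noise :=
  MeasurableEquiv.piCongrLeft (fun _ : ℤ => Bool) (Equiv.subRight m)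

theorem shift_apply (m k : ℤ) (ω : Noise) : shift m ω k = ω (k + m) := by
  have h := Equiv.piCongrLeft_apply_apply (fun _ : ℤ => Bool) (Equiv.subRight m) ω (k + m)
  rwa [Equiv.subRight_apply, add_sub_cancel_right] at h

theorem shift_shift (m n : ℤ) (ω : Noise) : shift m (shift n ω) = shift (m + n) ω := by
  funext k
  simp only [shift_apply, add_assoc]

theorem shift_zero (ω : Noise) : shift 0 ω = ω := by
  funext k
  rw [shift_apply, add_zero]

theorem measurePreserving_shift (ε : I) (m : ℤ) :
    MeasurePreserving (shift m) (noiseLaw ε) (noiseLaw ε) :=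
  ⟨(shift m).measurable, Measure.infinitePi_map_piCongrLeft
    (fun _ : ℤ => bernoulliMeasure false true ε) (Equiv.subRight m)⟩

theorem indepFun_of_dependsOn (ε : I) {β β' : Type*} [Nonempty β] [Nonempty β']
    [MeasurableSpace β] [MeasurableSpace β'] {f : Noise → β} {g : Noise → β'} {s t : Finset ℤ}
    (hf : DependsOn f (s : Set ℤ)) (hg : DependsOn g (t : Set ℤ)) (hst : Disjoint s t) :
    IndepFun f g (noiseLaw ε) := by
  obtain ⟨f', rfl⟩ := dependsOn_iff_exists_comp.1 hf
  obtain ⟨g', rfl⟩ := dependsOn_iff_exists_comp.1 hg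
  have h : iIndepFun (fun (i : ℤ) (ω : Noise) => ω i) (noiseLaw ε) :=
    iIndepFun_infinitePi (P := fun _ : ℤ => bernoulliMeasure false true ε)
      (X := fun _ x => x) (fun _ => measurable_id)
  exact (h.indepFun_finset s t hst fun i => measurable_pi_apply i).comp
    (measurable_of_countable f') (measurable_of_countable g')

theorem noiseLaw_real_forall_mem_eq (ε : I) (s : Finset ℤ) (c : Bool) :
    (noiseLaw ε).real {ω | ∀ k ∈ s, ω k = c} =
      (bernoulliMeasure false true ε).real {c} ^ s.card := by
  have h := Measure.infinitePi_pi (fun _ : ℤ => bernoulliMeasure false true ε) (s := s)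
    (t := fun _ => {c}) (fun _ _ => measurableSet_singleton _)
  rw [Finset.prod_const] at h
  simp only [Measure.real, ← ENNReal.toReal_pow, ← h]
  rfl

theorem noiseLaw_real_forall_mem_eq_false (ε : I) (s : Finset ℤ) :
    (noiseLaw ε).real {ω | ∀ k ∈ s, ω k = false} = (ε : ℝ) ^ s.card := by
  simp [noiseLaw_real_forall_mem_eq]

theorem noiseLaw_real_forall_mem_eq_true (ε : I) (s : Finset ℤ) :
    (noiseLaw ε).real {ω | ∀ k ∈ s, ω k = true} = (1 - ε : ℝ) ^ s.card := by
  simp [noiseLaw_real_forall_mem_eq]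

/-- The noise vanishes infinitely often in the past: the full-measure event on which `R` solves its
recursion at all times. -/
def ZerosInPast (ω : Noise) : Prop := ∀ n : ℤ, ∃ k : ℕ, 1 ≤ k ∧ ω (n - k) = false

theorem ae_zerosInPast {ε : I} (hε : 0 < ε) : ∀ᵐ ω ∂noiseLaw ε, ZerosInPast ω := by
  refine ae_all_iff.2 fun n => ?_
  rw [ae_iff, ← measureReal_eq_zero_iff]
  have hle (N : ℕ) : (noiseLaw ε).real {ω | ¬∃ k : ℕ, 1 ≤ k ∧ ω (n - k) = false} ≤
      (1 - ε : ℝ) ^ N := by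
    have h := noiseLaw_real_forall_mem_eq_true ε (Finset.Ico (n - N) n)
    rw [Int.card_Ico, sub_sub_cancel, Int.toNat_natCast] at h
    rw [← h]
    refine measureReal_mono fun ω hω k hk => ?_
    simp only [mem_ofPred_eq, not_exists, not_and, Bool.not_eq_false] at hω
    rw [Finset.mem_Ico] at hk
    have := hω (n - k).toNat (by omega)
    rwa [show n - ((n - k).toNat : ℤ) = k by omega] at this
  have hε0 : (0 : ℝ) < ε := hε
  have hlim := tendsto_pow_atTop_nhds_zero_of_lt_one (sub_nonneg.2 ε.2.2)
    (sub_lt_self 1 hε0)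
  exact le_antisymm (ge_of_tendsto' hlim hle) measureReal_nonneg

end Noise

section Coupling

theorem integrable_of_continuous {f : Noise → ℝ} (hf : Continuous f) (μ : Measure Noise)
    [IsFiniteMeasure μ] : Integrable f μ :=
  hf.integrable_of_hasCompactSupport (.of_compactSpace f)

/-- The noise at level `ε` obtained from uniform variables `u`. Using the same `u` for all levels
couples the laws `noiseLaw ε` monotonically and continuously in `ε`. -/
noncomputable def threshold (ε : I) (u : ℤ → I) : Noise := fun k => decide (ε < u k)

theorem measurable_decide_lt (ε : I) : Measurable fun x : I => decide (ε < x) :=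
  measurable_to_bool (by simpa [preimage, ← Ioi_def] using measurableSet_Ioi)

theorem measurable_threshold (ε : I) : Measurable (threshold ε) :=
  measurable_pi_lambda _ fun k => (measurable_decide_lt ε).comp (measurable_pi_apply k)

theorem antitone_threshold (u : ℤ → I) : Antitone fun ε => threshold ε u := fun ε ε' h k => by
  simpa [threshold, Bool.le_iff_imp] using h.trans_lt

theorem map_decide_lt (ε : I) :
    (volume : Measure I).map (fun x => decide (ε < x)) = bernoulliMeasure false true ε := by
  have := Measure.isProbabilityMeasure_map (μ := (volume : Measure I))
    (measurable_decide_lt ε).aemeasurable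
  refine Measure.ext_of_singleton fun c => (measureReal_eq_measureReal_iff).1 ?_
  rw [map_measureReal_apply (measurable_decide_lt ε) (measurableSet_singleton c), Measure.real]
  cases c with
  | false =>
    have h : (fun x => decide (ε < x)) ⁻¹' {false} = Iic ε := by ext; simp
    simp [h, unitInterval.volume_Iic, ε.2.1]
  | true =>
    have h : (fun x => decide (ε < x)) ⁻¹' {true} = Ioi ε := by ext; simp
    simp [h, unitInterval.volume_Ioi, ε.2.2]

theorem map_threshold (ε : I) :
    (Measure.infinitePi fun _ : ℤ => (volume : Measure I)).map (threshold ε) = noiseLaw ε := by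
  rw [noiseLaw, ← map_decide_lt]
  exact Measure.infinitePi_map_pi _ fun _ => measurable_decide_lt ε

theorem integral_noiseLaw_eq {f : Noise → ℝ} (hf : Continuous f) (ε : I) :
    ∫ ω, f ω ∂noiseLaw ε =
      ∫ u, f (threshold ε u) ∂Measure.infinitePi fun _ : ℤ => (volume : Measure I) := by
  rw [← map_threshold, integral_map (measurable_threshold ε).aemeasurable
    hf.aestronglyMeasurable]

theorem antitone_integral_noiseLaw {f : Noise → ℝ} (hf : Continuous f) (hmono : Monotone f) :
    Antitone fun ε : I => ∫ ω, f ω ∂noiseLaw ε := fun ε ε' h => by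
  simp only [integral_noiseLaw_eq hf]
  have hint (ε : I) : Integrable (fun u => f (threshold ε u))
      (Measure.infinitePi fun _ : ℤ => (volume : Measure I)) := by
    refine Integrable.comp_measurable ?_ (measurable_threshold ε)
    exact integrable_of_continuous hf _
  exact integral_mono (hint _) (hint _) fun u => hmono (antitone_threshold u h)

theorem continuousAt_threshold {ε : I} {u : ℤ → I} (hu : ∀ k, u k ≠ ε) :
    ContinuousAt (fun ε => threshold ε u) ε := by
  refine continuousAt_pi.2 fun k => ?_
  refine (tendsto_pure.2 ?_).mono_right (pure_le_nhds _)
  rcases (hu k).lt_or_gt with h | h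
  · filter_upwards [lt_mem_nhds h] with ε' h'
    simp [threshold, h.not_gt, h'.not_gt]
  · filter_upwards [gt_mem_nhds h] with ε' h'
    simp [threshold, h, h']

theorem continuous_integral_noiseLaw {f : Noise → ℝ} (hf : Continuous f) :
    Continuous fun ε : I => ∫ ω, f ω ∂noiseLaw ε := by
  simp only [integral_noiseLaw_eq hf]
  obtain ⟨K, hK⟩ := isCompact_univ.exists_bound_of_continuousOn hf.continuousOn
  refine continuous_iff_continuousAt.2 fun ε => ?_
  have hne : ∀ᵐ u ∂Measure.infinitePi fun _ : ℤ => (volume : Measure I), ∀ k, u k ≠ ε := by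
    refine ae_all_iff.2 fun k => ?_
    exact (measurePreserving_eval_infinitePi (fun _ : ℤ => (volume : Measure I)) k)
      |>.quasiMeasurePreserving.ae (Measure.ae_ne volume ε)
  refine continuousAt_of_dominated
    (.of_forall fun ε => (hf.measurable.comp (measurable_threshold ε)).aestronglyMeasurable)
    (.of_forall fun ε => .of_forall fun u => hK _ (mem_univ _)) (integrable_const K) ?_
  filter_upwards [hne] with u hu
  exact hf.continuousAt.comp' (continuousAt_threshold hu)

end Coupling

variable {a b : ℝ}

section Recursion

theorem η_shift (n m : ℤ) (ω : Noise) : η n (shift m ω) = η (n + m) ω := by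
  rw [η, η, shift_apply]

theorem η_nonneg (n : ℤ) (ω : Noise) : 0 ≤ η n ω := by
  unfold η
  split_ifs <;> simp

theorem η_le_one (n : ℤ) (ω : Noise) : η n ω ≤ 1 := by
  unfold η
  split_ifs <;> simp

theorem continuous_η (n : ℤ) : Continuous (η n) :=
  (continuous_of_discreteTopology (f := fun c : Bool => if c then (1 : ℝ) else 0)).comp
    (continuous_apply n)

theorem monotone_η (n : ℤ) : Monotone (η n) := fun ω ω' h => by
  have := Bool.le_iff_imp.1 (h n)
  cases hω : ω n <;> cases hω' : ω' n <;> simp_all [η]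

theorem X_zero (ω : Noise) : X a b 0 ω = 1 := by rw [X]

theorem X_one (ω : Noise) : X a b 1 ω = a := by rw [X]

theorem X_add_two (n : ℕ) (ω : Noise) :
    X a b (n + 2) ω = a * X a b (n + 1) ω + b * η (n : ℤ) ω * X a b n ω := by rw [X]

theorem X_pos (ha : 0 < a) (hb : 0 < b) (n : ℕ) (ω : Noise) : 0 < X a b n ω := by
  induction n using Nat.twoStepInduction with
  | zero => simp only [X_zero, one_pos]
  | one => simpa only [X_one]
  | more n h0 h1 =>
    rw [X_add_two]
    have := η_nonneg n ω
    positivity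

theorem continuous_X (n : ℕ) : Continuous (X a b n) := by
  induction n using Nat.twoStepInduction with
  | zero => simpa only [funext X_zero] using continuous_const
  | one => simpa only [funext X_one] using continuous_const
  | more n h0 h1 =>
    have := continuous_η n
    simp only [funext (X_add_two n)]
    fun_prop

theorem monotone_X (ha : 0 < a) (hb : 0 < b) (n : ℕ) : Monotone (X a b n) := fun ω ω' h => by
  induction n using Nat.twoStepInduction with
  | zero => simp only [X_zero, le_refl]
  | one => simp only [X_one, le_refl]
  | more n h0 h1 =>
    rw [X_add_two, X_add_two]
    have := monotone_η n h
    have := X_pos ha hb n ω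
    have := η_nonneg n ω'
    gcongr

theorem dependsOn_X (n : ℕ) : DependsOn (X a b n) (Finset.Ico 0 (n : ℤ) : Set ℤ) := by
  intro ω ω' h
  induction n using Nat.twoStepInduction with
  | zero => simp only [X_zero]
  | one => simp only [X_one]
  | more n h0 h1 =>
    simp only [Finset.coe_Ico, Set.mem_Ico] at *
    rw [X_add_two, X_add_two, h0 fun i hi => h i (by push_cast; omega),
      h1 fun i hi => h i (by push_cast at *; omega), η, η, h n (by push_cast; omega)]

theorem mul_X_le_X_succ (ha : 0 < a) (hb : 0 < b) (n : ℕ) (ω : Noise) :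
    a * X a b n ω ≤ X a b (n + 1) ω := by
  cases n with
  | zero => simp only [X_zero, X_one, mul_one, zero_add, le_refl]
  | succ n =>
    have := X_pos ha hb n ω
    have := η_nonneg n ω
    rw [X_add_two]
    exact le_add_of_nonneg_right (by positivity)

theorem X_succ_le (ha : 0 < a) (hb : 0 < b) (n : ℕ) (ω : Noise) :
    X a b (n + 1) ω ≤ (1 + b / a ^ 2) * (a * X a b n ω) := by
  cases n with
  | zero =>
    rw [X_zero, X_one, mul_one]
    exact le_mul_of_one_le_left ha.le (le_add_of_nonneg_right (by positivity))
  | succ n =>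
    have hpos := X_pos ha hb n ω
    have hstep := mul_X_le_X_succ ha hb n ω
    have hη : b * η n ω * X a b n ω ≤ b * 1 * X a b n ω := by
      gcongr
      exact η_le_one n ω
    calc X a b (n + 2) ω ≤ a * X a b (n + 1) ω + b / a * (a * X a b n ω) := by
          rw [X_add_two, ← mul_assoc (b / a), div_mul_cancel₀ _ ha.ne']
          linarith
      _ ≤ a * X a b (n + 1) ω + b / a * X a b (n + 1) ω := by gcongr
      _ = (1 + b / a ^ 2) * (a * X a b (n + 1) ω) := by field_simp

theorem X_of_forall_false {n : ℕ} {ω : Noise} (h : ∀ k ∈ Finset.Ico (0 : ℤ) n, ω k = false) :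
    X a b n ω = a ^ n := by
  rw [dependsOn_X n (y := fun _ => false) h]
  induction n using Nat.twoStepInduction with
  | zero => rw [X_zero, pow_zero]
  | one => rw [X_one, pow_one]
  | more n _ ih =>
    rw [X_add_two, ih fun k hk => h k (by simp only [Finset.mem_Ico] at *; push_cast; omega)]
    simp [η, pow_succ']

theorem X_const_true (n : ℕ) : X a b n (fun _ => true) = Z a b n := by
  induction n using Nat.twoStepInduction with
  | zero => rw [X_zero, Z]
  | one => rw [X_one, Z]
  | more n h0 h1 => simp only [X_add_two, Z, h0, h1, η, if_true, mul_one]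

theorem tendsto_Z_atTop (ha : 0 < a) (hb : 0 < b) (hab : 1 < a + b) :
    Tendsto (Z a b) atTop atTop := by
  obtain ⟨l, hl1, hl⟩ : ∃ l : ℝ, 1 < l ∧ l ^ 2 ≤ a * l + b := by
    have hcont : Tendsto (fun l : ℝ => a * l + b - l ^ 2) (𝓝[>] 1) (𝓝 (a * 1 + b - 1 ^ 2)) :=
      (Continuous.tendsto (by fun_prop) 1).mono_left nhdsWithin_le_nhds
    obtain ⟨l, hl, hl1⟩ := ((hcont.eventually_const_lt (u := 0) (by linarith)).and
      self_mem_nhdsWithin).exists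
    exact ⟨l, hl1, (sub_pos.1 hl).le⟩
  have hl0 : 0 < l := one_pos.trans hl1
  set c := min 1 (a / l)
  have hc : 0 < c := lt_min one_pos (by positivity)
  have hle (n : ℕ) : c * l ^ n ≤ Z a b n := by
    induction n using Nat.twoStepInduction with
    | zero => simpa only [Z, pow_zero, mul_one] using min_le_left _ _
    | one => simpa only [Z, pow_one] using (le_div_iff₀ hl0).1 (min_le_right 1 (a / l))
    | more n h0 h1 =>
      calc c * l ^ (n + 2) = c * l ^ n * l ^ 2 := by ring
        _ ≤ c * l ^ n * (a * l + b) := by gcongr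
        _ = a * (c * l ^ (n + 1)) + b * (c * l ^ n) := by ring
        _ ≤ a * Z a b (n + 1) + b * Z a b n := by gcongr
        _ = Z a b (n + 2) := by rw [Z]
  exact tendsto_atTop_mono hle ((tendsto_pow_atTop_atTop_of_one_lt hl1).const_mul_atTop hc)

end Recursion

section Comparison

/-- The logarithm of `X_n`: the additive functional whose growth rate is `γ`. -/
noncomputable def logX (a b : ℝ) (n : ℕ) (ω : Noise) : ℝ := Real.log (X a b n ω)

/-- The amount by which the logarithms of two positive solutions of the recursion, normalized to
agree at time `0`, can differ at any later time. -/
noncomputable def distortion (a b : ℝ) : ℝ := Real.log (1 + b / a ^ 2)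

theorem distortion_nonneg (hb : 0 < b) : 0 ≤ distortion a b :=
  Real.log_nonneg (le_add_of_nonneg_right (by positivity))

theorem solution_mem_Icc (ha : 0 < a) (hb : 0 < b) {y : ℕ → ℝ} {k : ℤ} {ω : Noise} (h0 : 0 < y 0)
    (hrec : ∀ n : ℕ, y (n + 2) = a * y (n + 1) + b * η (n + k) ω * y n)
    (h1 : y 1 ∈ Icc (a * y 0) ((1 + b / a ^ 2) * (a * y 0))) (n : ℕ) :
    y n ∈ Icc (y 0 * X a b n (shift k ω)) ((1 + b / a ^ 2) * (y 0 * X a b n (shift k ω))) := by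
  induction n using Nat.twoStepInduction with
  | zero =>
    rw [X_zero, mul_one]
    exact ⟨le_rfl, le_mul_of_one_le_left h0.le (le_add_of_nonneg_right (by positivity))⟩
  | one => rwa [X_one, mul_comm (y 0)]
  | more n ih0 ih1 =>
    rw [X_add_two, hrec, η_shift]
    have hη : 0 ≤ b * η (n + k) ω := mul_nonneg hb.le (η_nonneg _ ω)
    have lower := add_le_add (mul_le_mul_of_nonneg_left ih1.1 ha.le)
      (mul_le_mul_of_nonneg_left ih0.1 hη)
    have upper := add_le_add (mul_le_mul_of_nonneg_left ih1.2 ha.le)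
      (mul_le_mul_of_nonneg_left ih0.2 hη)
    constructor <;> linarith

theorem abs_log_solution_sub_le (ha : 0 < a) (hb : 0 < b) {y : ℕ → ℝ} {k : ℤ} {ω : Noise}
    (h0 : 0 < y 0) (hrec : ∀ n : ℕ, y (n + 2) = a * y (n + 1) + b * η (n + k) ω * y n)
    (h1 : y 1 ∈ Icc (a * y 0) ((1 + b / a ^ 2) * (a * y 0))) (n : ℕ) :
    |Real.log (y n) - (Real.log (y 0) + logX a b n (shift k ω))| ≤ distortion a b := by
  obtain ⟨hle, hge⟩ := solution_mem_Icc ha hb h0 hrec h1 n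
  have hX := X_pos ha hb n (shift k ω)
  have hyX : 0 < y 0 * X a b n (shift k ω) := mul_pos h0 hX
  have hy := hyX.trans_le hle
  have lower := Real.log_le_log hyX hle
  have upper := Real.log_le_log hy hge
  rw [Real.log_mul (by positivity) hyX.ne'] at upper
  rw [Real.log_mul h0.ne' hX.ne'] at lower upper
  rw [logX, distortion, abs_of_nonneg (sub_nonneg.2 lower)]
  linarith

theorem abs_logX_add_sub_le (ha : 0 < a) (hb : 0 < b) (m n : ℕ) (ω : Noise) :
    |logX a b (m + n) ω - (logX a b m ω + logX a b n (shift m ω))| ≤ distortion a b := by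
  refine abs_log_solution_sub_le ha hb (y := fun n => X a b (m + n) ω) (X_pos ha hb _ _)
    (fun n => ?_) ⟨mul_X_le_X_succ ha hb m ω, X_succ_le ha hb m ω⟩ n
  have h := X_add_two (a := a) (b := b) (m + n) ω
  rwa [Nat.cast_add, add_comm (m : ℤ)] at h

end Comparison

section StationaryRatios

theorem R_pos (ha : 0 < a) (hb : 0 < b) (n : ℤ) (ω : Noise) : 0 < R a b n ω :=
  div_pos (Z_pos ha hb _) (Z_pos ha hb _)

theorem inv_R_add_one (ha : 0 < a) (hb : 0 < b) {ω : Noise} (hω : ZerosInPast ω) (n : ℤ) :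
    (R a b (n + 1) ω)⁻¹ = a + b * η n ω * R a b n ω := by
  rw [R_recursion ha hb (n + 1) ω (hω _), inv_inv, add_sub_cancel_right]

theorem le_inv_R (ha : 0 < a) (hb : 0 < b) {ω : Noise} (hω : ZerosInPast ω) (n : ℤ) :
    a ≤ (R a b n ω)⁻¹ := by
  have h := inv_R_add_one ha hb hω (n - 1)
  have := R_pos ha hb (n - 1) ω
  have := η_nonneg (n - 1) ω
  rw [sub_add_cancel] at h
  rw [h]
  exact le_add_of_nonneg_right (by positivity)

theorem inv_R_le (ha : 0 < a) (hb : 0 < b) {ω : Noise} (hω : ZerosInPast ω) (n : ℤ) :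
    (R a b n ω)⁻¹ ≤ (1 + b / a ^ 2) * a := by
  have h := inv_R_add_one ha hb hω (n - 1)
  have := R_pos ha hb (n - 1) ω
  have hR : R a b (n - 1) ω ≤ a⁻¹ := (le_inv_comm₀ ha this).1 (le_inv_R ha hb hω _)
  rw [sub_add_cancel] at h
  calc (R a b n ω)⁻¹ = a + b * η (n - 1) ω * R a b (n - 1) ω := h
    _ ≤ a + b * 1 * a⁻¹ := by gcongr; exact η_le_one _ _
    _ = (1 + b / a ^ 2) * a := by field_simp

/-- The product `R_m R_{m+1} ⋯ R_{m+n-1}` of `n` consecutive stationary ratios. -/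
noncomputable def ratioProd (a b : ℝ) (m : ℤ) (n : ℕ) (ω : Noise) : ℝ :=
  ∏ i ∈ Finset.range n, R a b (m + i) ω

theorem ratioProd_succ (m : ℤ) (n : ℕ) (ω : Noise) :
    ratioProd a b m (n + 1) ω = ratioProd a b m n ω * R a b (m + n) ω :=
  Finset.prod_range_succ _ _

theorem ratioProd_pos (ha : 0 < a) (hb : 0 < b) (m : ℤ) (n : ℕ) (ω : Noise) :
    0 < ratioProd a b m n ω :=
  Finset.prod_pos fun _ _ => R_pos ha hb _ _

/-- The inverse products of the ratios solve the recursion of `X` started at time `m`. -/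
theorem abs_log_ratioProd_add_le (ha : 0 < a) (hb : 0 < b) {ω : Noise} (hω : ZerosInPast ω)
    (m : ℤ) (n : ℕ) :
    |Real.log (ratioProd a b m n ω) + logX a b n (shift m ω)| ≤ distortion a b := by
  have hrec (n : ℕ) : (ratioProd a b m (n + 2) ω)⁻¹ =
      a * (ratioProd a b m (n + 1) ω)⁻¹ + b * η (n + m) ω * (ratioProd a b m n ω)⁻¹ := by
    have hR := inv_R_add_one ha hb hω (m + n)
    have hpos := R_pos ha hb (m + n) ω
    rw [ratioProd_succ, ratioProd_succ, Nat.cast_succ, ← add_assoc, mul_inv, hR, mul_inv,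
      add_comm (n : ℤ) m]
    field_simp
  have h := abs_log_solution_sub_le ha hb (y := fun n => (ratioProd a b m n ω)⁻¹)
    (inv_pos.2 (ratioProd_pos ha hb m 0 ω)) hrec
    (by simpa [ratioProd] using ⟨le_inv_R ha hb hω m, inv_R_le ha hb hω m⟩) n
  have h0 : ratioProd a b m 0 ω = 1 := Finset.prod_range_zero _
  rw [h0, inv_one, Real.log_one, zero_add, Real.log_inv, ← neg_add', abs_neg] at h
  exact h

theorem abs_log_R_add_log_le (ha : 0 < a) (hb : 0 < b) {ω : Noise} (hω : ZerosInPast ω) (m : ℤ) :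
    |Real.log (R a b m ω) + Real.log a| ≤ distortion a b := by
  simpa [ratioProd, logX, X_one] using abs_log_ratioProd_add_le ha hb hω m 1

theorem X_eq_X_succ_mul_R (ha : 0 < a) (hb : 0 < b) {ω : Noise} (hω : ZerosInPast ω) (m : ℤ)
    {i : ℕ} (h : ∃ l : ℕ, l < i ∧ ω (m + l) = false) :
    X a b i (shift m ω) = X a b (i + 1) (shift m ω) * R a b (m + i) ω := by
  induction i with
  | zero => simp at h
  | succ i ih =>
    have hR := inv_R_add_one ha hb hω (m + i)
    have hpos := R_pos ha hb (m + i + 1) ω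
    rw [Nat.cast_succ, ← add_assoc, ← mul_inv_eq_iff_eq_mul₀ hpos.ne', hR, X_add_two, η_shift,
      add_comm (i : ℤ) m]
    cases hi : ω (m + i) with
    | false => simp [η, hi, mul_comm]
    | true =>
      obtain ⟨l, hl, hωl⟩ := h
      have hne : l ≠ i := by rintro rfl; simp [hi] at hωl
      rw [ih ⟨l, by omega, hωl⟩]
      ring

/-- The state of the chain of ratios `X_i / X_{i+1}` is reset by a zero of the noise. -/
theorem X_eq_X_add_mul_ratioProd (ha : 0 < a) (hb : 0 < b) {ω : Noise} (hω : ZerosInPast ω)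
    (m : ℤ) {i : ℕ} (n : ℕ) (h : ∃ l : ℕ, l < i ∧ ω (m + l) = false) :
    X a b i (shift m ω) = X a b (i + n) (shift m ω) * ratioProd a b (m + i) n ω := by
  induction n with
  | zero => simp [ratioProd]
  | succ n ih =>
    obtain ⟨l, hl, hωl⟩ := h
    rw [ih, X_eq_X_succ_mul_R ha hb hω m ⟨l, Nat.lt_add_right n hl, hωl⟩, ratioProd_succ,
      Nat.cast_add, ← add_assoc (m : ℤ), ← add_assoc i]
    ring

theorem age_shift (n m : ℤ) (ω : Noise) : age n (shift m ω) = age (n + m) ω := by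
  simp only [age, shift_apply, sub_add_eq_add_sub]

theorem R_shift (n m : ℤ) (ω : Noise) : R a b n (shift m ω) = R a b (n + m) ω := by
  rw [R, R, age_shift]

theorem measurable_age (n : ℤ) : Measurable (age n) :=
  measurable_sInf_nat fun k => (MeasurableSet.const (1 ≤ k)).inter
    (measurableSet_eq_fun (measurable_pi_apply (n - (k : ℤ))) measurable_const)

theorem measurable_R (n : ℤ) : Measurable (R a b n) :=
  (measurable_of_countable fun k : ℕ => Z a b (k - 1) / Z a b k).comp (measurable_age n)

theorem measurable_ratioProd (m : ℤ) (n : ℕ) : Measurable (ratioProd a b m n) :=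
  Finset.measurable_prod _ fun _ _ => measurable_R _

end StationaryRatios

section Lyapunov

theorem continuous_logX (ha : 0 < a) (hb : 0 < b) (n : ℕ) : Continuous (logX a b n) :=
  (continuous_X n).log fun ω => (X_pos ha hb n ω).ne'

theorem monotone_logX (ha : 0 < a) (hb : 0 < b) (n : ℕ) : Monotone (logX a b n) :=
  fun ω _ h => Real.log_le_log (X_pos ha hb n ω) (monotone_X ha hb n h)

theorem continuous_shift (m : ℤ) : Continuous (shift m) :=
  continuous_pi fun k => by simpa only [shift_apply] using continuous_apply (k + m)

theorem continuous_logX_shift (ha : 0 < a) (hb : 0 < b) (n : ℕ) (m : ℤ) :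
    Continuous fun ω => logX a b n (shift m ω) :=
  (continuous_logX ha hb n).comp (continuous_shift m)

theorem abs_integral_logX_add_sub_le (ha : 0 < a) (hb : 0 < b) (ε : I) (m n : ℕ) :
    |∫ ω, logX a b (m + n) ω ∂noiseLaw ε -
      (∫ ω, logX a b m ω ∂noiseLaw ε + ∫ ω, logX a b n ω ∂noiseLaw ε)| ≤ distortion a b := by
  have hm := integrable_of_continuous (continuous_logX ha hb m) (noiseLaw ε)
  have hn := integrable_of_continuous (continuous_logX_shift ha hb n m) (noiseLaw ε)
  rw [← (measurePreserving_shift ε m).integral_comp' (logX a b n), ← integral_add hm hn]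
  exact abs_integral_sub_integral_le (integrable_of_continuous (continuous_logX ha hb _) _)
    (hm.add hn) (.of_forall fun ω => abs_logX_add_sub_le ha hb m n ω)

theorem abs_integral_logX_sub_le (ha : 0 < a) (hb : 0 < b) (ε : I) (n : ℕ) :
    |∫ ω, logX a b n ω ∂noiseLaw ε - n * γ a b ε| ≤ distortion a b := by
  obtain ⟨L, hL⟩ := exists_abs_sub_mul_le_of_almost_additive
    (u := fun n => ∫ ω, logX a b n ω ∂noiseLaw ε) (abs_integral_logX_add_sub_le ha hb ε)
  have hγ : γ a b ε = L := (tendsto_inv_mul_of_abs_sub_mul_le hL).limUnder_eq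
  rw [hγ]
  exact hL n

theorem tendsto_integral_logX (ha : 0 < a) (hb : 0 < b) (ε : I) :
    Tendsto (fun n : ℕ => (n : ℝ)⁻¹ * ∫ ω, logX a b n ω ∂noiseLaw ε) atTop (𝓝 (γ a b ε)) :=
  tendsto_inv_mul_of_abs_sub_mul_le (abs_integral_logX_sub_le ha hb ε)

theorem antitone_γ (ha : 0 < a) (hb : 0 < b) : Antitone (γ a b) := fun ε ε' h =>
  le_of_tendsto_of_tendsto' (tendsto_integral_logX ha hb ε') (tendsto_integral_logX ha hb ε)
    fun n => mul_le_mul_of_nonneg_left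
      (antitone_integral_noiseLaw (continuous_logX ha hb n) (monotone_logX ha hb n) h)
      (by positivity)

theorem continuous_γ (ha : 0 < a) (hb : 0 < b) : Continuous (γ a b) := by
  refine TendstoUniformly.continuous (p := atTop)
    (F := fun (n : ℕ) ε => (n : ℝ)⁻¹ * ∫ ω, logX a b n ω ∂noiseLaw ε) ?_
    (.of_forall fun n => continuous_const.mul
      (continuous_integral_noiseLaw (continuous_logX ha hb n)))
  refine Metric.tendstoUniformly_iff.2 fun δ hδ => ?_
  filter_upwards [(tendsto_const_div_atTop_nhds_zero_nat (distortion a b)).eventually_lt_const hδ,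
    eventually_gt_atTop 0] with n hn hn0 ε
  have hn0' : (0 : ℝ) < n := by exact_mod_cast hn0
  refine lt_of_le_of_lt ?_ hn
  rw [dist_comm, Real.dist_eq, le_div_iff₀ hn0', ← abs_of_pos hn0', ← abs_mul, abs_of_pos hn0',
    sub_mul, mul_right_comm, inv_mul_cancel₀ hn0'.ne', one_mul, mul_comm (γ a b ε)]
  exact abs_integral_logX_sub_le ha hb ε n

theorem noiseLaw_zero : noiseLaw 0 = Measure.dirac fun _ => true := by
  simp [noiseLaw, Measure.infinitePi_dirac (fun _ : ℤ => true)]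

theorem noiseLaw_one : noiseLaw 1 = Measure.dirac fun _ => false := by
  simp [noiseLaw, Measure.infinitePi_dirac (fun _ : ℤ => false)]

theorem γ_zero_pos (ha : 0 < a) (hb : 0 < b) (hab : 1 < a + b) : 0 < γ a b 0 := by
  obtain ⟨n, hn⟩ := ((Real.tendsto_log_atTop.comp (tendsto_Z_atTop ha hb hab)).eventually_gt_atTop
    (distortion a b)).exists
  have h := (abs_le.1 (abs_integral_logX_sub_le ha hb 0 n)).2
  rw [noiseLaw_zero, integral_dirac, logX, X_const_true] at h
  refine pos_of_mul_pos_right (a := (n : ℝ)) ?_ n.cast_nonneg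
  rw [Function.comp_apply] at hn
  linarith

theorem γ_one (ha : 0 < a) (hb : 0 < b) : γ a b 1 = Real.log a := by
  refine tendsto_nhds_unique (tendsto_integral_logX ha hb 1)
    (tendsto_inv_mul_of_abs_sub_mul_le (C := 0) fun n => ?_)
  rw [noiseLaw_one, integral_dirac, logX, X_of_forall_false fun _ _ => rfl, Real.log_pow, sub_self,
    abs_zero]

theorem εstar_spec (ha : a ∈ Ioo (0 : ℝ) 1) (hb : 1 - a < b) :
    (εstar a b ∈ Ioo (0 : I) 1 ∧ γ a b (εstar a b) = 0) ∧ ∀ ε, 0 < γ a b ε ↔ ε < εstar a b := by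
  have hb0 : 0 < b := by linarith [ha.2]
  have h0 := γ_zero_pos ha.1 hb0 (by linarith)
  have h1 : γ a b 1 < 0 := by simpa only [γ_one ha.1 hb0] using Real.log_neg ha.1 ha.2
  exact sSup_setOf_pos_spec (continuous_γ ha.1 hb0) (antitone_γ ha.1 hb0) h0 h1

end Lyapunov

section MomentExponent

theorem integrable_exp_mul_of_continuous {f : Noise → ℝ} (hf : Continuous f) (μ : Measure Noise)
    [IsFiniteMeasure μ] (t : ℝ) : Integrable (fun ω => Real.exp (t * f ω)) μ :=
  integrable_of_continuous (by fun_prop) μ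

theorem abs_cgf_neg_logX_add_sub_le (ha : 0 < a) (hb : 0 < b) (ε : I) (t : ℝ) (m n : ℕ) :
    |cgf (-logX a b (m + n)) (noiseLaw ε) t -
      (cgf (-logX a b m) (noiseLaw ε) t + cgf (-logX a b n) (noiseLaw ε) t)| ≤
      |t| * distortion a b := by
  have hm := (continuous_logX ha hb m).neg
  have hn := (continuous_logX_shift ha hb n m).neg
  have hindep : IndepFun (-logX a b m) (fun ω => -logX a b n (shift m ω)) (noiseLaw ε) := by
    refine indepFun_of_dependsOn ε (s := Finset.Ico 0 (m : ℤ)) (t := Finset.Ico (m : ℤ) (m + n))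
      (fun ω ω' h => ?_) (fun ω ω' h => ?_) ?_
    · simp only [Pi.neg_apply, logX, dependsOn_X m h]
    · have hX : X a b n (shift m ω) = X a b n (shift m ω') := dependsOn_X n fun i hi => by
        rw [shift_apply, shift_apply, h]
        simp only [Finset.coe_Ico, mem_Ico] at hi ⊢
        omega
      rw [logX, logX, hX]
    · exact Finset.Ico_disjoint_Ico_consecutive _ _ _
  have hshift : cgf (fun ω => -logX a b n (shift m ω)) (noiseLaw ε) t =
      cgf (-logX a b n) (noiseLaw ε) t :=
    congrArg Real.log ((measurePreserving_shift ε m).integral_comp'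
      fun ω => Real.exp (t * (-logX a b n) ω))
  rw [← hshift, ← hindep.cgf_add (integrable_exp_mul_of_continuous hm _ t)
    (integrable_exp_mul_of_continuous hn _ t)]
  refine abs_cgf_sub_cgf_le
    (integrable_exp_mul_of_continuous (continuous_logX ha hb _).neg _ t)
    (integrable_exp_mul_of_continuous (hm.add hn) _ t) (.of_forall fun ω => ?_)
  have h := abs_logX_add_sub_le ha hb m n ω
  rw [← abs_neg] at h
  convert h using 2
  simp only [Pi.neg_apply, Pi.add_apply]
  ring

theorem ae_abs_log_ratioProd_add_le (ha : 0 < a) (hb : 0 < b) {ε : I} (hε : 0 < ε) (m : ℤ)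
    (n : ℕ) : ∀ᵐ ω ∂noiseLaw ε,
      |Real.log (ratioProd a b m n ω) - -logX a b n (shift m ω)| ≤ distortion a b := by
  filter_upwards [ae_zerosInPast hε] with ω hω
  rw [sub_neg_eq_add]
  exact abs_log_ratioProd_add_le ha hb hω m n

theorem abs_cgf_log_ratioProd_sub_le (ha : 0 < a) (hb : 0 < b) {ε : I} (hε : 0 < ε) (t : ℝ)
    (n : ℕ) : |cgf (fun ω => Real.log (ratioProd a b 1 n ω)) (noiseLaw ε) t -
      cgf (-logX a b n) (noiseLaw ε) t| ≤ |t| * distortion a b := by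
  have hshift : cgf (fun ω => -logX a b n (shift 1 ω)) (noiseLaw ε) t =
      cgf (-logX a b n) (noiseLaw ε) t :=
    congrArg Real.log ((measurePreserving_shift ε 1).integral_comp'
      fun ω => Real.exp (t * (-logX a b n) ω))
  have hclose := ae_abs_log_ratioProd_add_le ha hb hε 1 n
  have hexp := integrable_exp_mul_of_continuous (continuous_logX_shift ha hb n 1).neg
    (noiseLaw ε) t
  rw [← hshift]
  exact abs_cgf_sub_cgf_le (integrable_exp_mul_of_abs_sub_le
    (measurable_ratioProd 1 n).log.aemeasurable hexp hclose) hexp hclose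

theorem prod_Icc_R (n : ℕ) (ω : Noise) :
    ∏ k ∈ Finset.Icc 1 n, R a b (k : ℤ) ω = ratioProd a b 1 n ω := by
  induction n with
  | zero => rfl
  | succ n ih =>
    rw [Finset.prod_Icc_succ_top (Nat.le_add_left 1 n), ih, ratioProd_succ, Nat.cast_succ,
      add_comm 1]

theorem log_integral_prod_R_rpow (ha : 0 < a) (hb : 0 < b) (ε : I) (t : ℝ) (n : ℕ) :
    Real.log (∫ ω, ∏ k ∈ Finset.Icc 1 n, R a b (k : ℤ) ω ^ t ∂noiseLaw ε) =
      cgf (fun ω => Real.log (ratioProd a b 1 n ω)) (noiseLaw ε) t := by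
  refine congrArg Real.log (integral_congr_ae (.of_forall fun ω => ?_))
  simp only [Real.finsetProd_rpow _ _ fun _ _ => (R_pos ha hb _ _).le, prod_Icc_R,
    Real.rpow_def_of_pos (ratioProd_pos ha hb 1 n ω), mul_comm t]

theorem log_integral_X_rpow (ha : 0 < a) (hb : 0 < b) (ε : I) (t : ℝ) (n : ℕ) :
    Real.log (∫ ω, X a b n ω ^ (-t) ∂noiseLaw ε) = cgf (-logX a b n) (noiseLaw ε) t := by
  refine congrArg Real.log (integral_congr_ae (.of_forall fun ω => ?_))
  simp only [Real.rpow_def_of_pos (X_pos ha hb n ω), Pi.neg_apply, logX, mul_neg, neg_mul,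
    mul_comm t]

theorem abs_cgf_neg_logX_sub_le (ha : 0 < a) (hb : 0 < b) {ε : I} (hε : 0 < ε) (n : ℕ) (t : ℝ) :
    |cgf (-logX a b n) (noiseLaw ε) t - n * Λ a b ε t| ≤ |t| * distortion a b := by
  obtain ⟨L, hL⟩ := exists_abs_sub_mul_le_of_almost_additive
    (u := fun n => cgf (-logX a b n) (noiseLaw ε) t) (abs_cgf_neg_logX_add_sub_le ha hb ε t)
  have hratio (n : ℕ) : |cgf (fun ω => Real.log (ratioProd a b 1 n ω)) (noiseLaw ε) t - n * L| ≤
      |t| * distortion a b + |t| * distortion a b :=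
    (abs_sub_le _ _ _).trans (add_le_add (abs_cgf_log_ratioProd_sub_le ha hb hε t n) (hL n))
  have hΛ : Λ a b ε t = L := by
    simp only [Λ, log_integral_prod_R_rpow ha hb]
    exact (tendsto_inv_mul_of_abs_sub_mul_le hratio).limUnder_eq
  rw [hΛ]
  exact hL n

theorem tendsto_cgf_neg_logX (ha : 0 < a) (hb : 0 < b) {ε : I} (hε : 0 < ε) (t : ℝ) :
    Tendsto (fun n : ℕ => (n : ℝ)⁻¹ * cgf (-logX a b n) (noiseLaw ε) t) atTop (𝓝 (Λ a b ε t)) :=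
  tendsto_inv_mul_of_abs_sub_mul_le fun n => abs_cgf_neg_logX_sub_le ha hb hε n t

theorem tendsto_cgf_log_ratioProd (ha : 0 < a) (hb : 0 < b) {ε : I} (hε : 0 < ε) (t : ℝ) :
    Tendsto (fun n : ℕ => (n : ℝ)⁻¹ *
      cgf (fun ω => Real.log (ratioProd a b 1 n ω)) (noiseLaw ε) t) atTop (𝓝 (Λ a b ε t)) :=
  tendsto_inv_mul_of_abs_sub_mul_le fun n => (abs_sub_le _ _ _).trans
    (add_le_add (abs_cgf_log_ratioProd_sub_le ha hb hε t n) (abs_cgf_neg_logX_sub_le ha hb hε n t))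

theorem Λ_zero (ha : 0 < a) (hb : 0 < b) {ε : I} (hε : 0 < ε) : Λ a b ε 0 = 0 :=
  tendsto_nhds_unique (tendsto_cgf_neg_logX ha hb hε 0) (by simp)

theorem hasDerivAt_Λ_zero (ha : 0 < a) (hb : 0 < b) {ε : I} (hε : 0 < ε) :
    HasDerivAt (Λ a b ε) (-γ a b ε) 0 := by
  refine hasDerivAt_zero_of_abs_sub_mul_le (F := fun n => cgf (-logX a b n) (noiseLaw ε))
    (d := fun n => -∫ ω, logX a b n ω ∂noiseLaw ε) (fun n => cgf_zero) (fun n => ?_) ?_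
    (abs_cgf_neg_logX_sub_le ha hb hε)
  · have hint : integrableExpSet (-logX a b n) (noiseLaw ε) = univ := eq_univ_of_forall
      (integrable_exp_mul_of_continuous (continuous_logX ha hb n).neg (noiseLaw ε))
    have hmem : 0 ∈ interior (integrableExpSet (-logX a b n) (noiseLaw ε)) := by simp [hint]
    simpa [deriv_cgf_zero hmem, integral_neg] using
      (analyticAt_cgf hmem).differentiableAt.hasDerivAt
  · simpa only [mul_neg] using (tendsto_integral_logX ha hb ε).neg

theorem convexOn_Λ (ha : 0 < a) (hb : 0 < b) {ε : I} (hε : 0 < ε) :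
    ConvexOn ℝ univ (Λ a b ε) := by
  have hcgf (n : ℕ) : ConvexOn ℝ univ (cgf (-logX a b n) (noiseLaw ε)) :=
    convexOn_cgf.subset (fun t _ => integrable_exp_mul_of_continuous
      (continuous_logX ha hb n).neg (noiseLaw ε) t) convex_univ
  refine ⟨convex_univ, fun s _ t _ p q hp hq hpq => ?_⟩
  refine le_of_tendsto_of_tendsto' (tendsto_cgf_neg_logX ha hb hε _)
    (((tendsto_cgf_neg_logX ha hb hε s).const_mul p).add
      ((tendsto_cgf_neg_logX ha hb hε t).const_mul q)) fun n => ?_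
  have h := mul_le_mul_of_nonneg_left ((hcgf n).2 (mem_univ s) (mem_univ t) hp hq hpq)
    (inv_nonneg.2 (Nat.cast_nonneg (α := ℝ) n))
  simp only [smul_eq_mul] at h ⊢
  linarith

theorem log_sub_le_Λ (ha : 0 < a) (hb : 0 < b) {ε : I} (hε : 0 < ε) {t : ℝ} (ht : 0 ≤ t) :
    Real.log ε - t * Real.log a ≤ Λ a b ε t := by
  have hε0 : (0 : ℝ) < ε := hε
  refine le_of_tendsto_of_tendsto (tendsto_inv_mul_of_abs_sub_mul_le (C := 0)
    (u := fun n => n * (Real.log ε - t * Real.log a)) fun n => by simp)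
    (tendsto_cgf_neg_logX ha hb hε t) (.of_forall fun n => ?_)
  have hzeros : (ε : ℝ) ^ n ≤ (noiseLaw ε).real {ω | -(n * Real.log a) ≤ (-logX a b n) ω} := by
    have h := noiseLaw_real_forall_mem_eq_false ε (Finset.Ico 0 (n : ℤ))
    rw [Int.card_Ico, sub_zero, Int.toNat_natCast] at h
    rw [← h]
    refine measureReal_mono fun ω hω => ?_
    rw [mem_ofPred_eq, Pi.neg_apply, logX, X_of_forall_false hω, Real.log_pow]
  have hchernoff := hzeros.trans (measure_ge_le_exp_cgf _ ht
    (integrable_exp_mul_of_continuous (continuous_logX ha hb n).neg (noiseLaw ε) t))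
  have h := Real.log_le_log (pow_pos hε0 n) hchernoff
  rw [Real.log_pow, Real.log_exp] at h
  refine mul_le_mul_of_nonneg_left ?_ (by positivity)
  linarith

theorem exists_Λ_pos (ha : a ∈ Ioo (0 : ℝ) 1) (hb : 0 < b) {ε : I} (hε : 0 < ε) :
    ∃ t, 0 < t ∧ 0 < Λ a b ε t := by
  have hlim : Tendsto (fun t : ℝ => Real.log ε + t * -Real.log a) atTop atTop :=
    tendsto_atTop_add_const_left _ _
      (tendsto_id.atTop_mul_const (neg_pos.2 (Real.log_neg ha.1 ha.2)))
  obtain ⟨t, ht, ht0⟩ := ((hlim.eventually_gt_atTop 0).and (eventually_gt_atTop 0)).exists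
  exact ⟨t, ht0, by linarith [log_sub_le_Λ ha.1 hb hε ht0.le]⟩

theorem γ_pos_iff_existsUnique_Λ_eq_zero (ha : a ∈ Ioo (0 : ℝ) 1) (hb : 0 < b) {ε : I}
    (hε : 0 < ε) : 0 < γ a b ε ↔ ∃! s : ℝ, 0 < s ∧ Λ a b ε s = 0 := by
  rw [← neg_lt_zero]
  exact deriv_neg_iff_existsUnique_zero
    ((convexOn_Λ ha.1 hb hε).subset (subset_univ _) (convex_Ici 0)) (Λ_zero ha.1 hb hε)
    (hasDerivAt_Λ_zero ha.1 hb hε).hasDerivWithinAt (exists_Λ_pos ha hb hε)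

end MomentExponent

section StrongLaw

theorem ae_eventually_abs_logX_shift_sub_lt (ha : 0 < a) (hb : 0 < b) {ε : I} (hε : 0 < ε)
    {δ : ℝ} (hδ : 0 < δ) (s : ℕ → ℤ) :
    ∀ᵐ ω ∂noiseLaw ε, ∀ᶠ n : ℕ in atTop,
      |logX a b n (shift (s n) ω) - n * γ a b ε| < n * δ := by
  have hsum := tsum_measure_abs_sub_ge_ne_top (Y := fun n => -logX a b n) (ψ := Λ a b ε)
    (fun n => integrable_exp_mul_of_continuous (continuous_logX ha hb n).neg (noiseLaw ε))
    (abs_cgf_neg_logX_sub_le ha hb hε) (Λ_zero ha hb hε) (hasDerivAt_Λ_zero ha hb hε) hδ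
  have hshift (n : ℕ) := (measurePreserving_shift ε (s n)).measure_preimage_equiv
    {ω | n * δ ≤ |(-logX a b n) ω - n * -γ a b ε|}
  rw [← tsum_congr hshift] at hsum
  filter_upwards [ae_eventually_notMem hsum] with ω hω
  filter_upwards [hω] with n hn
  rw [mem_preimage, mem_ofPred_eq, not_le, Pi.neg_apply] at hn
  rwa [← abs_neg, neg_sub', ← mul_neg]

theorem ae_tendsto_logX (ha : 0 < a) (hb : 0 < b) {ε : I} (hε : 0 < ε) :
    ∀ᵐ ω ∂noiseLaw ε, Tendsto (fun n : ℕ => (n : ℝ)⁻¹ * logX a b n ω) atTop (𝓝 (γ a b ε)) := by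
  have h (k : ℕ) := ae_eventually_abs_logX_shift_sub_lt ha hb hε
    (Nat.one_div_pos_of_nat (α := ℝ) (n := k)) fun _ => 0
  filter_upwards [ae_all_iff.2 h] with ω hω
  refine Metric.tendsto_nhds.2 fun δ hδ => ?_
  obtain ⟨k, hk⟩ := exists_nat_one_div_lt hδ
  filter_upwards [hω k, eventually_gt_atTop 0] with n hn hn0
  have hn0' : (0 : ℝ) < n := Nat.cast_pos.2 hn0
  rw [shift_zero] at hn
  rw [Real.dist_eq, ← mul_lt_mul_iff_of_pos_left hn0', ← abs_of_pos hn0', ← abs_mul, mul_sub,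
    abs_of_pos hn0', mul_inv_cancel_left₀ hn0'.ne']
  exact hn.trans (mul_lt_mul_of_pos_left hk hn0')

end StrongLaw

section Perpetuity

theorem W_eq_tsum_ratioProd (ω : Noise) :
    W a b ω = ∑' k : ℕ, ENNReal.ofReal (ratioProd a b (-k) (k + 1) ω) := by
  refine tsum_congr fun k => congrArg ENNReal.ofReal ?_
  rw [ratioProd, ← Finset.prod_range_reflect]
  refine Finset.prod_congr rfl fun j hj => ?_
  rw [Finset.mem_range] at hj
  congr 1
  omega

theorem measurable_W : Measurable (W a b) := by
  simp only [funext W_eq_tsum_ratioProd]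
  exact .tsum fun k => (measurable_ratioProd _ _).ennreal_ofReal

theorem W_shift_one (ha : 0 < a) (hb : 0 < b) (ω : Noise) :
    W a b (shift 1 ω) = ENNReal.ofReal (R a b 1 ω) * (1 + W a b ω) := by
  have hterm (k : ℕ) : ∏ j ∈ Finset.range (k + 1), R a b (-(j : ℤ)) (shift 1 ω) =
      R a b 1 ω * ∏ j ∈ Finset.range k, R a b (-(j : ℤ)) ω := by
    simp only [Finset.prod_range_succ' _ k, R_shift, Nat.cast_succ, neg_add, neg_add_cancel_right,
      Nat.cast_zero, neg_zero, zero_add, mul_comm (R a b 1 ω)]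
  simp only [W, hterm, ENNReal.ofReal_mul (R_pos ha hb 1 ω).le]
  rw [ENNReal.tsum_mul_left, tsum_eq_zero_add' ENNReal.summable, Finset.prod_range_zero,
    ENNReal.ofReal_one]

theorem toReal_W_pos (ha : 0 < a) (hb : 0 < b) {ω : Noise} (hω : W a b ω ≠ ∞) :
    0 < (W a b ω).toReal := by
  refine ENNReal.toReal_pos (ne_of_gt ?_) hω
  rw [W_eq_tsum_ratioProd]
  exact (ENNReal.ofReal_pos.2 (ratioProd_pos ha hb _ _ ω)).trans_le (ENNReal.le_tsum 0)

theorem log_W_shift_one_sub (ha : 0 < a) (hb : 0 < b) {ω : Noise} (hω : W a b ω ≠ ∞) :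
    Real.log (W a b (shift 1 ω)).toReal - Real.log (W a b ω).toReal =
      Real.log (R a b 1 ω) + Real.log (1 + (W a b ω).toReal⁻¹) := by
  have hW := toReal_W_pos ha hb hω
  have hR := R_pos ha hb 1 ω
  have hshift : (W a b (shift 1 ω)).toReal = R a b 1 ω * (1 + (W a b ω).toReal) := by
    rw [W_shift_one ha hb, ENNReal.toReal_mul, ENNReal.toReal_ofReal hR.le,
      ENNReal.toReal_add ENNReal.one_ne_top hω, ENNReal.toReal_one]
  have hinv : 1 + (W a b ω).toReal⁻¹ = (1 + (W a b ω).toReal) / (W a b ω).toReal := by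
    field_simp
    ring
  rw [hshift, hinv, Real.log_mul hR.ne' (by positivity), Real.log_div (by positivity) hW.ne']
  ring

theorem ae_W_lt_top (ha : 0 < a) (hb : 0 < b) {ε : I} (hε : 0 < ε) (hγ : 0 < γ a b ε) :
    ∀ᵐ ω ∂noiseLaw ε, W a b ω < ∞ := by
  filter_upwards [ae_zerosInPast hε,
    ae_eventually_abs_logX_shift_sub_lt ha hb hε (half_pos hγ) fun n => 1 - n] with ω hω hlog
  have hgeom : Summable fun k : ℕ =>
      Real.exp (distortion a b) * Real.exp (-(γ a b ε / 2)) ^ (k + 1) :=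
    ((summable_nat_add_iff 1).2 (summable_geometric_of_lt_one (Real.exp_nonneg _)
      (Real.exp_lt_one_iff.2 (by linarith)))).mul_left _
  rw [W_eq_tsum_ratioProd]
  refine (hgeom.of_norm_bounded_eventually_nat
    (f := fun k : ℕ => ratioProd a b (-k) (k + 1) ω) ?_).tsum_ofReal_ne_top.lt_top
  filter_upwards [(tendsto_add_atTop_nat 1).eventually hlog] with k hk
  have hpos := ratioProd_pos ha hb (-k) (k + 1) ω
  have hratio := (abs_le.1 (abs_log_ratioProd_add_le ha hb hω (-k) (k + 1))).2
  rw [show (1 - (k + 1 : ℕ) : ℤ) = -k by push_cast; ring] at hk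
  rw [Real.norm_eq_abs, abs_of_pos hpos, ← Real.exp_nat_mul, ← Real.exp_add,
    ← Real.log_le_iff_le_exp hpos]
  linarith [(abs_lt.1 hk).1]

theorem ae_abs_log_R_le (ha : 0 < a) (hb : 0 < b) {ε : I} (hε : 0 < ε) (m : ℤ) :
    ∀ᵐ ω ∂noiseLaw ε, |Real.log (R a b m ω)| ≤ distortion a b + |Real.log a| := by
  filter_upwards [ae_zerosInPast hε] with ω hω
  calc |Real.log (R a b m ω)| = |Real.log (R a b m ω) + Real.log a - Real.log a| := by
        rw [add_sub_cancel_right]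
    _ ≤ |Real.log (R a b m ω) + Real.log a| + |Real.log a| := abs_sub _ _
    _ ≤ distortion a b + |Real.log a| := by gcongr; exact abs_log_R_add_log_le ha hb hω m

theorem integrable_log_R (ha : 0 < a) (hb : 0 < b) {ε : I} (hε : 0 < ε) (m : ℤ) :
    Integrable (fun ω => Real.log (R a b m ω)) (noiseLaw ε) :=
  .of_bound (measurable_R m).log.aestronglyMeasurable _ (ae_abs_log_R_le ha hb hε m)

theorem log_ratioProd (ha : 0 < a) (hb : 0 < b) (m : ℤ) (n : ℕ) (ω : Noise) :
    Real.log (ratioProd a b m n ω) = ∑ i ∈ Finset.range n, Real.log (R a b (m + i) ω) :=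
  Real.log_prod fun _ _ => (R_pos ha hb _ ω).ne'

theorem integral_log_ratioProd (ha : 0 < a) (hb : 0 < b) {ε : I} (hε : 0 < ε) (m : ℤ) (n : ℕ) :
    ∫ ω, Real.log (ratioProd a b m n ω) ∂noiseLaw ε =
      n * ∫ ω, Real.log (R a b m ω) ∂noiseLaw ε := by
  have hstat (i : ℕ) : ∫ ω, Real.log (R a b (m + i) ω) ∂noiseLaw ε =
      ∫ ω, Real.log (R a b m ω) ∂noiseLaw ε := by
    rw [← (measurePreserving_shift ε i).integral_comp' fun ω => Real.log (R a b m ω)]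
    simp only [R_shift]
  simp only [log_ratioProd ha hb]
  rw [integral_finsetSum _ fun i _ => integrable_log_R ha hb hε _, Finset.sum_congr rfl
    fun i _ => hstat i, Finset.sum_const, Finset.card_range, nsmul_eq_mul]

theorem integral_log_R (ha : 0 < a) (hb : 0 < b) {ε : I} (hε : 0 < ε) (m : ℤ) :
    ∫ ω, Real.log (R a b m ω) ∂noiseLaw ε = -γ a b ε := by
  set e := ∫ ω, Real.log (R a b m ω) ∂noiseLaw ε
  have hdist (n : ℕ) : |n * e - n * -γ a b ε| ≤ distortion a b + distortion a b := by
    have hR : Integrable (fun ω => Real.log (ratioProd a b m n ω)) (noiseLaw ε) := by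
      simp only [log_ratioProd ha hb]
      exact integrable_finsetSum _ fun i _ => integrable_log_R ha hb hε _
    have hclose := abs_integral_sub_integral_le hR
      (integrable_of_continuous (continuous_logX_shift ha hb n m).neg (noiseLaw ε))
      (ae_abs_log_ratioProd_add_le ha hb hε m n)
    rw [integral_log_ratioProd ha hb hε, integral_neg',
      (measurePreserving_shift ε m).integral_comp' (logX a b n)] at hclose
    have hγ := abs_integral_logX_sub_le ha hb ε n
    rw [abs_le] at *
    constructor <;> linarith
  exact tendsto_nhds_unique
    (tendsto_inv_mul_of_abs_sub_mul_le (C := 0) (u := fun n => n * e) fun n => by simp)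
    (tendsto_inv_mul_of_abs_sub_mul_le hdist)

theorem integral_log_R_one_neg (ha : 0 < a) (hb : 0 < b) {ε : I} (hε : 0 < ε)
    (hW : ∀ᵐ ω ∂noiseLaw ε, W a b ω < ∞) : ∫ ω, Real.log (R a b 1 ω) ∂noiseLaw ε < 0 := by
  set g : Noise → ℝ := fun ω => Real.log (1 + (W a b ω).toReal⁻¹)
  have hg : ∀ᵐ ω ∂noiseLaw ε, 0 < g ω := hW.mono fun ω hω =>
    Real.log_pos (lt_add_of_pos_right 1 (inv_pos.2 (toReal_W_pos ha hb hω.ne)))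
  have hcob : (fun ω => Real.log (W a b (shift 1 ω)).toReal - Real.log (W a b ω).toReal)
      =ᵐ[noiseLaw ε] fun ω => Real.log (R a b 1 ω) + g ω :=
    hW.mono fun ω hω => log_W_shift_one_sub ha hb hω.ne
  have hK : 0 ≤ distortion a b + |Real.log a| := add_nonneg (distortion_nonneg hb) (abs_nonneg _)
  have hbound : ∀ᵐ ω ∂noiseLaw ε, Real.log (W a b ω).toReal ≤
      Real.log (W a b (shift 1 ω)).toReal + (distortion a b + |Real.log a|) := by
    filter_upwards [hcob, hg, ae_abs_log_R_le ha hb hε 1] with ω hω hgω hR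
    linarith [(abs_le.1 hR).1]
  have hmeas : Measurable fun ω => Real.log (W a b ω).toReal := measurable_W.ennreal_toReal.log
  have hT := measurePreserving_shift ε 1
  have hR := integrable_log_R ha hb hε 1
  have hgi : Integrable g (noiseLaw ε) := by
    simpa [Pi.sub_def] using ((integrable_coboundary hT hmeas hK hbound).congr hcob).sub hR
  have hle := integral_coboundary_nonpos hT hmeas hK hbound
  have hgpos : 0 < ∫ ω, g ω ∂noiseLaw ε :=
    (integral_pos_iff_support_of_nonneg_ae (hg.mono fun _ => le_of_lt) hgi).2
      (pos_iff_ne_zero.2 fun h0 => by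
        obtain ⟨ω, hω, h⟩ := (hg.and (measure_eq_zero_iff_ae_notMem.1 h0)).exists
        exact h hω.ne')
  rw [integral_congr_ae hcob, integral_add hR hgi] at hle
  linarith

theorem γ_pos_of_ae_W_lt_top (ha : 0 < a) (hb : 0 < b) {ε : I} (hε : 0 < ε)
    (hW : ∀ᵐ ω ∂noiseLaw ε, W a b ω < ∞) : 0 < γ a b ε := by
  have h := integral_log_R_one_neg ha hb hε hW
  rwa [integral_log_R ha hb hε, neg_lt_zero] at h

theorem frequently_ae_eq {ε : I} (hε : ε ∈ Ioo (0 : I) 1) (k : ℤ) (v : Bool) :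
    ∃ᵐ ω ∂noiseLaw ε, ω k = v := by
  have hε0 : (0 : ℝ) < ε := hε.1
  have hε1 : (ε : ℝ) < 1 := hε.2
  have h : 0 < (noiseLaw ε).real {ω | ∀ i ∈ ({k} : Finset ℤ), ω i = v} := by
    cases v with
    | false => simpa only [noiseLaw_real_forall_mem_eq_false] using pow_pos hε0 _
    | true => simpa only [noiseLaw_real_forall_mem_eq_true] using pow_pos (sub_pos.2 hε1) _
  simp only [Finset.mem_singleton, forall_eq] at h
  exact frequently_ae_iff.2 fun h0 => h.ne' (by rw [Measure.real, h0, ENNReal.toReal_zero])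

theorem not_ae_R_eq_const (ha : 0 < a) (hb : 0 < b) {ε : I} (hε : ε ∈ Ioo (0 : I) 1) (r : ℝ) :
    ¬∀ᵐ ω ∂noiseLaw ε, R a b 1 ω = r := by
  intro h
  have hz := ae_zerosInPast hε.1
  obtain ⟨ω, hω, hr, hωz⟩ := ((frequently_ae_eq hε 0 false).and_eventually (h.and hz)).exists
  obtain ⟨ω', hω', hr', hωz'⟩ := ((frequently_ae_eq hε 0 true).and_eventually (h.and hz)).exists
  have hstep := inv_R_add_one ha hb hωz 0
  have hstep' := inv_R_add_one ha hb hωz' 0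
  rw [zero_add, hr, η, hω, if_neg Bool.false_ne_true, mul_zero, zero_mul, add_zero] at hstep
  rw [zero_add, hr', η, hω', if_pos rfl, mul_one, hstep] at hstep'
  linarith [mul_pos hb (R_pos ha hb 0 ω')]

theorem not_ae_W_eq_const (ha : 0 < a) (hb : 0 < b) {ε : I} (hε : ε ∈ Ioo (0 : I) 1)
    (hW : ∀ᵐ ω ∂noiseLaw ε, W a b ω < ∞) : ¬∃ c : ℝ≥0∞, ∀ᵐ ω ∂noiseLaw ε, W a b ω = c := by
  rintro ⟨c, hc⟩
  refine not_ae_R_eq_const ha hb hε (c / (1 + c)).toReal ?_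
  filter_upwards [hW, hc, (measurePreserving_shift ε 1).quasiMeasurePreserving.ae hc]
    with ω hlt hω hshift
  rw [hω] at hlt
  rw [W_shift_one ha hb, hω] at hshift
  rw [← ENNReal.eq_div_iff (by simp) (by simp [hlt.ne]) |>.2 ((mul_comm _ _).trans hshift),
    ENNReal.toReal_ofReal (R_pos ha hb 1 ω).le]

end Perpetuity

section Distribution

theorem X_le_mul_ratioProd (ha : 0 < a) (hb : 0 < b) {ω : Noise} (hω : ZerosInPast ω)
    (m : ℤ) (i n : ℕ) : X a b i (shift m ω) ≤ Real.exp (distortion a b + distortion a b) *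
      (X a b (i + n) (shift m ω) * ratioProd a b (m + i) n ω) := by
  have hX := X_pos ha hb (i + n) (shift m ω)
  have hR := ratioProd_pos ha hb (m + i) n ω
  have hadd := (abs_le.1 (abs_logX_add_sub_le ha hb i n (shift m ω))).1
  have hratio := (abs_le.1 (abs_log_ratioProd_add_le ha hb hω (m + i) n)).1
  rw [shift_shift, add_comm (i : ℤ)] at hadd
  rw [← Real.log_le_log_iff (X_pos ha hb i _) (by positivity), Real.log_mul (Real.exp_ne_zero _)
    (by positivity), Real.log_exp, Real.log_mul hX.ne' hR.ne']
  simp only [logX] at hadd hratio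
  linarith

/-- The `k`-th summand of `W_n`, counted from the last one, for the noise shifted so that time
`n - 1` becomes time `0`; it is `0` for `k ≥ n`. As `n → ∞` it approaches the `k`-th summand of `W`
for almost every fixed noise. -/
noncomputable def backwardTerm (a b : ℝ) (n k : ℕ) (ω : Noise) : ℝ :=
  if k < n then X a b (n - 1 - k) (shift (1 - n) ω) / X a b n (shift (1 - n) ω) else 0

theorem backwardTerm_of_le {n k : ℕ} (h : n ≤ k) (ω : Noise) : backwardTerm a b n k ω = 0 :=
  if_neg h.not_gt

theorem backwardTerm_add_succ (i k : ℕ) (ω : Noise) : backwardTerm a b (i + (k + 1)) k ω =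
    X a b i (shift (-k - i) ω) / X a b (i + (k + 1)) (shift (-k - i) ω) := by
  have hshift : 1 - ((i + (k + 1) : ℕ) : ℤ) = -k - i := by push_cast; ring
  rw [backwardTerm, if_pos (by omega), hshift, show i + (k + 1) - 1 - k = i by omega]

theorem backwardTerm_nonneg (ha : 0 < a) (hb : 0 < b) (n k : ℕ) (ω : Noise) :
    0 ≤ backwardTerm a b n k ω := by
  unfold backwardTerm
  split_ifs
  exacts [div_nonneg (X_pos ha hb _ _).le (X_pos ha hb _ _).le, le_rfl]

theorem ofReal_partialW_shift (ha : 0 < a) (hb : 0 < b) (n : ℕ) (ω : Noise) :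
    ENNReal.ofReal (partialW a b n (shift (1 - n) ω)) =
      ∑' k, ENNReal.ofReal (backwardTerm a b n k ω) := by
  rw [tsum_eq_sum (s := Finset.range n), partialW, ← Finset.sum_range_reflect, Finset.sum_div,
    ← ENNReal.ofReal_sum_of_nonneg fun k _ => backwardTerm_nonneg ha hb n k ω]
  · exact congrArg ENNReal.ofReal
      (Finset.sum_congr rfl fun k hk => (if_pos (Finset.mem_range.1 hk)).symm)
  · intro k hk
    rw [backwardTerm_of_le (by simpa using hk), ENNReal.ofReal_zero]

theorem backwardTerm_le (ha : 0 < a) (hb : 0 < b) {ω : Noise} (hω : ZerosInPast ω) (n k : ℕ) :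
    backwardTerm a b n k ω ≤
      Real.exp (distortion a b + distortion a b) * ratioProd a b (-k) (k + 1) ω := by
  have hR := ratioProd_pos ha hb (-k) (k + 1) ω
  rcases le_or_gt n k with h | h
  · rw [backwardTerm_of_le h]
    positivity
  · obtain ⟨i, rfl⟩ := Nat.exists_eq_add_of_le' h
    have hle := X_le_mul_ratioProd ha hb hω (-k - i) i (k + 1)
    rw [sub_add_cancel] at hle
    rw [backwardTerm_add_succ, div_le_iff₀ (X_pos ha hb _ _)]
    linarith

theorem eventually_backwardTerm_eq (ha : 0 < a) (hb : 0 < b) {ω : Noise} (hω : ZerosInPast ω)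
    (k : ℕ) : ∀ᶠ n in atTop, backwardTerm a b n k ω = ratioProd a b (-k) (k + 1) ω := by
  obtain ⟨j, hj, hj0⟩ := hω (-k)
  filter_upwards [eventually_ge_atTop (j + (k + 1))] with n hn
  obtain ⟨i, rfl⟩ := Nat.exists_eq_add_of_le' hn
  have hreset : ω (-k - (i + j : ℕ) + i) = false := by
    rw [← hj0]
    congr 1
    push_cast
    ring
  have h := X_eq_X_add_mul_ratioProd ha hb hω (-k - (i + j : ℕ)) (k + 1)
    ⟨i, Nat.lt_add_of_pos_right hj, hreset⟩
  rw [sub_add_cancel] at h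
  rw [← add_assoc, backwardTerm_add_succ, div_eq_iff (X_pos ha hb _ _).ne', h, mul_comm]

theorem tendsto_partialW_shift (ha : 0 < a) (hb : 0 < b) {ω : Noise} (hω : ZerosInPast ω) :
    Tendsto (fun n : ℕ => ENNReal.ofReal (partialW a b n (shift (1 - n) ω))) atTop
      (𝓝 (W a b ω)) := by
  simp only [ofReal_partialW_shift ha hb, W_eq_tsum_ratioProd]
  refine tendsto_tsum_of_le_const_mul ENNReal.ofReal_ne_top
    (C := ENNReal.ofReal (Real.exp (distortion a b + distortion a b))) (fun k => ?_) fun n k => ?_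
  · exact tendsto_const_nhds.congr' ((eventually_backwardTerm_eq ha hb hω k).mono fun n hn =>
      congrArg ENNReal.ofReal hn.symm)
  · rw [← ENNReal.ofReal_mul (Real.exp_nonneg _)]
    exact ENNReal.ofReal_le_ofReal (backwardTerm_le ha hb hω n k)

theorem measurable_partialW (n : ℕ) : Measurable (partialW a b n) :=
  (Finset.measurable_sum _ fun k _ => (continuous_X k).measurable).div (continuous_X n).measurable

theorem tendstoInDistribution_partialW (ha : 0 < a) (hb : 0 < b) {ε : I} (hε : 0 < ε) :
    TendstoInDistribution (fun n ω => ENNReal.ofReal (partialW a b n ω)) atTop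
      (W a b) (fun _ : ℕ => noiseLaw ε) (noiseLaw ε) := by
  have hm (n : ℕ) : Measurable fun ω => ENNReal.ofReal (partialW a b n ω) :=
    (measurable_partialW n).ennreal_ofReal
  have hT (n : ℕ) := measurePreserving_shift ε (1 - n)
  have hback := tendstoInDistribution_of_ae_tendsto (μ' := noiseLaw ε) (l := atTop)
    (X := fun (n : ℕ) ω => ENNReal.ofReal (partialW a b n (shift (1 - n) ω))) (Z := W a b)
    (fun n => ((hm n).comp (hT n).measurable).aemeasurable) measurable_W.aemeasurable
    ((ae_zerosInPast hε).mono fun ω hω => tendsto_partialW_shift ha hb hω)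
  refine ⟨fun n => (hm n).aemeasurable, measurable_W.aemeasurable,
    hback.tendsto.congr fun n => Subtype.ext ?_⟩
  exact (Measure.map_map (hm n) (hT n).measurable).symm.trans
    (congrArg (Measure.map _) (hT n).map_eq)

end Distribution

end RandomFib

theorem proposition3p2 (a b : ℝ) (ha : a ∈ Ioo (0 : ℝ) 1) (hb : 1 - a < b)
    (ε : I) (hε : ε ∈ Ioo (0 : I) 1) :
    -- the objects in the equivalence are well defined
    (RandomFib.εstar a b ∈ Ioo (0 : I) 1 ∧ RandomFib.γ a b (RandomFib.εstar a b) = 0) ∧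
    Tendsto (fun n : ℕ => (n : ℝ)⁻¹ * ∫ ω, Real.log (RandomFib.X a b n ω) ∂(RandomFib.noiseLaw ε))
      atTop (𝓝 (RandomFib.γ a b ε)) ∧
    (∀ᵐ ω ∂(RandomFib.noiseLaw ε),
      Tendsto (fun n : ℕ => (n : ℝ)⁻¹ * Real.log (RandomFib.X a b n ω))
        atTop (𝓝 (RandomFib.γ a b ε))) ∧
    (∀ t : ℝ, 0 ≤ t →
      Tendsto (fun n : ℕ => (n : ℝ)⁻¹ * Real.log
          (∫ ω, ∏ k ∈ Finset.Icc 1 n, RandomFib.R a b (k : ℤ) ω ^ t ∂(RandomFib.noiseLaw ε)))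
        atTop (𝓝 (RandomFib.Λ a b ε t)) ∧
      Tendsto (fun n : ℕ => (n : ℝ)⁻¹ * Real.log
          (∫ ω, RandomFib.X a b n ω ^ (-t) ∂(RandomFib.noiseLaw ε)))
        atTop (𝓝 (RandomFib.Λ a b ε t))) ∧
    DifferentiableWithinAt ℝ (RandomFib.Λ a b ε) (Ici 0) 0 ∧
    TendstoInDistribution (fun n ω => ENNReal.ofReal (RandomFib.partialW a b n ω)) atTop
      (RandomFib.W a b) (fun _ : ℕ => RandomFib.noiseLaw ε) (RandomFib.noiseLaw ε) ∧
    -- the equivalence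
    List.TFAE [
      0 < RandomFib.γ a b ε,
      ε < RandomFib.εstar a b,
      derivWithin (RandomFib.Λ a b ε) (Ici 0) 0 < 0,
      ∃! s : ℝ, 0 < s ∧ RandomFib.Λ a b ε s = 0,
      (∀ᵐ ω ∂(RandomFib.noiseLaw ε), RandomFib.W a b ω < ∞) ∧
        ¬ ∃ c : ℝ≥0∞, ∀ᵐ ω ∂(RandomFib.noiseLaw ε), RandomFib.W a b ω = c] := by
  have hb0 : 0 < b := by linarith [ha.2]
  have hderiv := (RandomFib.hasDerivAt_Λ_zero ha.1 hb0 hε.1).hasDerivWithinAt (s := Ici 0)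
  refine ⟨(RandomFib.εstar_spec ha hb).1, RandomFib.tendsto_integral_logX ha.1 hb0 ε,
    RandomFib.ae_tendsto_logX ha.1 hb0 hε.1, fun t _ => ⟨?_, ?_⟩,
    hderiv.differentiableWithinAt, RandomFib.tendstoInDistribution_partialW ha.1 hb0 hε.1, ?_⟩
  · simpa only [RandomFib.log_integral_prod_R_rpow ha.1 hb0] using
      RandomFib.tendsto_cgf_log_ratioProd ha.1 hb0 hε.1 t
  · simpa only [RandomFib.log_integral_X_rpow ha.1 hb0] using
      RandomFib.tendsto_cgf_neg_logX ha.1 hb0 hε.1 t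
  tfae_have 1 ↔ 2 := (RandomFib.εstar_spec ha hb).2 ε
  tfae_have 1 ↔ 3 := by
    rw [hderiv.derivWithin (uniqueDiffOn_Ici 0 0 self_mem_Ici), neg_lt_zero]
  tfae_have 1 ↔ 4 := RandomFib.γ_pos_iff_existsUnique_Λ_eq_zero ha hb0 hε.1
  tfae_have 1 → 5 := fun h =>
    have hW := RandomFib.ae_W_lt_top ha.1 hb0 hε.1 h
    ⟨hW, RandomFib.not_ae_W_eq_const ha.1 hb0 hε hW⟩
  tfae_have 5 → 1 := fun h => RandomFib.γ_pos_of_ae_W_lt_top ha.1 hb0 hε.1 h.1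
  tfae_finish
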